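/- Let $d\ge 1$ and let $A$ be a $d\times d$ integral matrix with $|\det A|=2$ which is expansive, that is, all of whose complex eigenvalues have modulus $>1$. Assume that $A\mathbb{Z}^d=A^{\tau}\mathbb{Z}^d$ (where $A^\tau$ is the transpose), and that there are $\vec\ell_A,\vec q_A\in\mathbb{Z}^d$ such that $\mathbb{Z}^d$ is the disjoint union of $\vec\ell_A+A\mathbb{Z}^d$ and $A\mathbb{Z}^d$, with $\vec q_A\circ\vec n$ even for all $\vec n\in A\mathbb{Z}^d$ and odd for all $\vec n\in\vec\ell_A+A\mathbb{Z}^d$ (here $\circ$ is the standard dot product). Let $\{h_{\vec n}\}_{\vec n\in\mathbb{Z}^d}$ be a finitely supported family of complex numbers satisfying Lawton's equations $$\sum_{\vec n\in\mathbb{Z}^d}h_{\vec n}\overline{h_{\vec n+\vec k}}=\delta_{\vec 0\vec k}\quad(\vec k\in A\mathbb{Z}^d),\qquad \sum_{\vec n\in\mathbb{Z}^d}h_{\vec n}=\sqrt2 .$$ Put $$m_0(\vec t)=\frac1{\sqrt2}\sum_{\vec n}h_{\vec n}e^{-i\vec n\circ\vec t},\qquad g(\vec\xi)=\frac1{(2\pi)^{d/2}}\prod_{j=1}^{\infty}m_0\big((A^\tau)^{-j}\vec\xi\big)\qquad(\vec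 t,\vec\xi\in\mathbb{R}^d).$$ Then the infinite product converges at every $\vec\xi\in\mathbb{R}^d$ and $g\in L^2(\mathbb{R}^d)$. Let $\varphi=\mathcal F^{-1}g\in L^2(\mathbb{R}^d)$ be the scaling function, where $\mathcal F$ is the unitary Fourier transform on $L^2(\mathbb{R}^d)$ that extends $(\mathcal F f)(\vec s)=(2\pi)^{-d/2}\int_{\mathbb{R}^d}e^{-i\vec s\circ\vec t}f(\vec t)\,d\vec t$. Let $T_{\vec\ell}f(\vec t)=f(\vec t-\vec\ell)$ and let $D_A$ be the unitary operator $D_Af(\vec t)=\sqrt{|\det A|}\,f(A\vec t)$ on $L^2(\mathbb{R}^d)$. For $f\in L^2(\mathbb{R}^d)$ and $J\in\mathbb{Z}$ put $$L_J(f)=\sum_{\vec\ell\in\mathbb{Z}^d}\big|\langle f,D_A^JT_{\vec\ell}\,\varphi\rangle\big|^2 .$$ Then for every $f\in L^2(\mathbb{R}^d)$ the series $L_J(f)$ converges for every $J\in\mathbb{Z}$, and $$\lim_{J\to+\infty}L_J(f)=\|f\|^2,\qquad \lim_{J\to-\infty}L_J(f)=0 .$$ -/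

import Mathlib

noncomputable section

namespace ParsevalWavelet

open MeasureTheory Matrix
open scoped FourierTransform ENNReal

/-- The Euclidean space `ℝ^d`. -/
abbrev Rd (d : ℕ) : Type := EuclideanSpace ℝ (Fin d)

/-- The Hilbert space `L²(ℝ^d)` of complex-valued functions (Lebesgue measure). -/
abbrev L2 (d : ℕ) : Type := Lp ℂ 2 (volume : Measure (Rd d))

/-- An integral matrix regarded as a real matrix. -/
def realMat {d : ℕ} (A : Matrix (Fin d) (Fin d) ℤ) : Matrix (Fin d) (Fin d) ℝ :=
  A.map (Int.cast : ℤ → ℝ)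

/-- `A` is expansive: every complex eigenvalue has modulus larger than `1`. -/
def IsExpansive {d : ℕ} (A : Matrix (Fin d) (Fin d) ℤ) : Prop :=
  ∀ β ∈ spectrum ℂ (A.map (Int.cast : ℤ → ℂ)), 1 < ‖β‖

/-- The sublattice `A ℤ^d` of `ℤ^d`. -/
def latticeImage {d : ℕ} (A : Matrix (Fin d) (Fin d) ℤ) : Set (Fin d → ℤ) :=
  Set.range fun n : Fin d → ℤ => A *ᵥ n

/-- The lattice properties that are standing assumptions on `A`: `A ℤ^d = Aᵀ ℤ^d`, and there are
`ℓ, q ∈ ℤ^d` such that `ℤ^d` is the disjoint union of `ℓ + A ℤ^d` and `A ℤ^d`, the integer `q ∘ n`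
being even on `A ℤ^d` and odd on `ℓ + A ℤ^d`. -/
def HasPartition {d : ℕ} (A : Matrix (Fin d) (Fin d) ℤ) : Prop :=
  latticeImage A = latticeImage Aᵀ ∧
  ∃ ℓ q : Fin d → ℤ,
    ((fun n => ℓ + n) '' latticeImage A) ∪ latticeImage A = Set.univ ∧
    Disjoint ((fun n => ℓ + n) '' latticeImage A) (latticeImage A) ∧
    (∀ n ∈ latticeImage A, Even (q ⬝ᵥ n)) ∧
    (∀ n ∈ (fun n => ℓ + n) '' latticeImage A, Odd (q ⬝ᵥ n))

/-- `h` is a finite (that is, finitely supported) solution to Lawton's equations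
associated with `A`. -/
def IsLawtonSolution {d : ℕ} (A : Matrix (Fin d) (Fin d) ℤ) (h : (Fin d → ℤ) →₀ ℂ) : Prop :=
  (∀ k ∈ latticeImage A,
    (h.sum fun n c => c * (starRingEnd ℂ) (h (n + k))) = if k = 0 then 1 else 0) ∧
  (h.sum fun _ c => c) = (Real.sqrt 2 : ℂ)

/-- The filter function `m₀(t) = 2^{-1/2} ∑ₙ hₙ e^{-i n∘t}`. -/
def filterFun {d : ℕ} (h : (Fin d → ℤ) →₀ ℂ) (t : Rd d) : ℂ :=
  (1 / (Real.sqrt 2 : ℂ)) *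
    h.sum fun n c => c * Complex.exp (-Complex.I * ((∑ i, (n i : ℝ) * t i : ℝ) : ℂ))

/-- The `j`-th factor `m₀((Aᵀ)^{-j} ξ)` of the infinite product. -/
def factor {d : ℕ} (A : Matrix (Fin d) (Fin d) ℤ) (h : (Fin d → ℤ) →₀ ℂ) (ξ : Rd d) (j : ℕ) : ℂ :=
  filterFun h (toEuclideanLin (((realMat A)ᵀ)⁻¹ ^ j) ξ)

/-- `g(ξ) = (2π)^{-d/2} ∏_{j ≥ 1} m₀((Aᵀ)^{-j} ξ)`. -/
def gFun {d : ℕ} (A : Matrix (Fin d) (Fin d) ℤ) (h : (Fin d → ℤ) →₀ ℂ) (ξ : Rd d) : ℂ :=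
  (1 / (((2 * Real.pi) ^ ((d : ℝ) / 2) : ℝ) : ℂ)) * ∏' j : ℕ, factor A h ξ (j + 1)

section UnitaryOperators

variable {d : ℕ}

theorem det_toEuclideanLin (M : Matrix (Fin d) (Fin d) ℝ) :
    LinearMap.det (toEuclideanLin M : Rd d →ₗ[ℝ] Rd d) = M.det := by
  rw [toEuclideanLin, toLpLin_eq_toLin, LinearMap.det_toLin]

theorem map_toEuclideanLin (M : Matrix (Fin d) (Fin d) ℝ) (hM : M.det ≠ 0) :
    Measure.map (toEuclideanLin M : Rd d → Rd d) volume
      = ENNReal.ofReal |M.det⁻¹| • (volume : Measure (Rd d)) := by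
  have := Measure.map_linearMap_addHaar_eq_smul_addHaar (volume : Measure (Rd d))
    (f := toEuclideanLin M) (by rwa [det_toEuclideanLin])
  rwa [det_toEuclideanLin] at this

theorem measurable_toEuclideanLin (M : Matrix (Fin d) (Fin d) ℝ) :
    Measurable (toEuclideanLin M : Rd d → Rd d) :=
  (LinearMap.continuous_of_finiteDimensional _).measurable

theorem quasiMeasurePreserving_toEuclideanLin (M : Matrix (Fin d) (Fin d) ℝ) (hM : M.det ≠ 0) :
    Measure.QuasiMeasurePreserving (toEuclideanLin M : Rd d → Rd d) volume volume :=
  ⟨measurable_toEuclideanLin M, by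
    rw [map_toEuclideanLin M hM]; exact Measure.smul_absolutelyContinuous⟩

theorem eLpNorm_comp_toEuclideanLin (M : Matrix (Fin d) (Fin d) ℝ) (hM : M.det ≠ 0)
    {f : Rd d → ℂ} (hf : AEStronglyMeasurable f volume) :
    eLpNorm (fun t => (Real.sqrt |M.det| : ℂ) * f (toEuclideanLin M t)) 2 volume
      = eLpNorm f 2 volume := by
  have h1 : eLpNorm (fun t => f (toEuclideanLin M t)) 2 volume
      = ENNReal.ofReal |M.det⁻¹| ^ (1 / 2 : ℝ) * eLpNorm f 2 volume := by
    have h2 := eLpNorm_map_measure (p := 2) (μ := (volume : Measure (Rd d)))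
      (f := (toEuclideanLin M : Rd d → Rd d)) (g := f)
      (by rw [map_toEuclideanLin M hM]; exact hf.mono_ac Measure.smul_absolutelyContinuous)
      (measurable_toEuclideanLin M).aemeasurable
    rw [map_toEuclideanLin M hM, eLpNorm_smul_measure_of_ne_top (by simp)] at h2
    simpa [Function.comp_def] using h2.symm
  have h3 : (fun t => (Real.sqrt |M.det| : ℂ) * f (toEuclideanLin M t))
      = (Real.sqrt |M.det| : ℂ) • fun t => f (toEuclideanLin M t) := rfl
  rw [h3, eLpNorm_const_smul, h1, ← mul_assoc]
  have h4 : ‖(Real.sqrt |M.det| : ℂ)‖ₑ * ENNReal.ofReal |M.det⁻¹| ^ (1 / 2 : ℝ) = 1 := by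
    have hpos : 0 < |M.det| := abs_pos.mpr hM
    rw [← ofReal_norm, Complex.norm_real, Real.norm_of_nonneg (Real.sqrt_nonneg _),
      ENNReal.ofReal_rpow_of_nonneg (abs_nonneg _) (by norm_num),
      ← ENNReal.ofReal_mul (Real.sqrt_nonneg _), ← Real.sqrt_eq_rpow, abs_inv,
      ← Real.sqrt_mul hpos.le, mul_inv_cancel₀ hpos.ne']
    simp
  rw [h4, one_mul]

theorem memLp_comp_toEuclideanLin (M : Matrix (Fin d) (Fin d) ℝ) (hM : M.det ≠ 0) (f : L2 d) :
    MemLp (fun t => (Real.sqrt |M.det| : ℂ) * f (toEuclideanLin M t)) 2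
      (volume : Measure (Rd d)) := by
  have hf := Lp.memLp f
  refine ⟨?_, ?_⟩
  · exact (hf.1.comp_quasiMeasurePreserving
      (quasiMeasurePreserving_toEuclideanLin M hM)).const_mul _
  · rw [eLpNorm_comp_toEuclideanLin M hM hf.1]
    exact hf.2

/-- The function `(U_M f)(t) = √|det M| f(M t)` as an element of `L²(ℝ^d)`. -/
def UFun (M : Matrix (Fin d) (Fin d) ℝ) (hM : M.det ≠ 0) (f : L2 d) : L2 d :=
  (memLp_comp_toEuclideanLin M hM f).toLp _

theorem coeFn_UFun (M : Matrix (Fin d) (Fin d) ℝ) (hM : M.det ≠ 0) (f : L2 d) :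
    (UFun M hM f : Rd d → ℂ)
      =ᵐ[volume] fun t => (Real.sqrt |M.det| : ℂ) * f (toEuclideanLin M t) :=
  MemLp.coeFn_toLp _

theorem UFun_UFun (M N : Matrix (Fin d) (Fin d) ℝ) (hM : M.det ≠ 0) (hN : N.det ≠ 0)
    (hMN : M * N = 1) (f : L2 d) : UFun N hN (UFun M hM f) = f := by
  apply Lp.ext
  have h1 := coeFn_UFun N hN (UFun M hM f)
  have h2 := (quasiMeasurePreserving_toEuclideanLin N hN).ae (coeFn_UFun M hM f)
  filter_upwards [h1, h2] with t h1 h2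
  rw [h1, h2, ← mul_assoc, ← Complex.ofReal_mul, ← Real.sqrt_mul (abs_nonneg _), ← abs_mul,
    ← det_mul, mul_eq_one_comm.mp hMN]
  have h3 : toEuclideanLin M (toEuclideanLin N t) = t := by
    ext i
    simp [toLpLin_apply, mulVec_mulVec, hMN]
  rw [h3]
  simp

/-- The unitary operator `U_M` on `L²(ℝ^d)`, `(U_M f)(t) = √|det M| f(M t)`, for an invertible real
matrix `M`. -/
def U (M : Matrix (Fin d) (Fin d) ℝ) (hM : M.det ≠ 0) : L2 d ≃ₗᵢ[ℂ] L2 d where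
  toFun := UFun M hM
  invFun := UFun M⁻¹ (by rw [det_nonsing_inv]; simpa using hM)
  left_inv f := UFun_UFun M M⁻¹ hM _ (mul_nonsing_inv M (Ne.isUnit hM)) f
  right_inv f := UFun_UFun M⁻¹ M _ hM (nonsing_inv_mul M (Ne.isUnit hM)) f
  map_add' f g := by
    apply Lp.ext
    have h1 := (quasiMeasurePreserving_toEuclideanLin M hM).ae (Lp.coeFn_add f g)
    filter_upwards [coeFn_UFun M hM (f + g), coeFn_UFun M hM f, coeFn_UFun M hM g,
      Lp.coeFn_add (UFun M hM f) (UFun M hM g), h1] with t a b c e h1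
    rw [a, e, h1, Pi.add_apply, Pi.add_apply, b, c, mul_add]
  map_smul' z f := by
    apply Lp.ext
    have h1 := (quasiMeasurePreserving_toEuclideanLin M hM).ae (Lp.coeFn_smul z f)
    filter_upwards [coeFn_UFun M hM (z • f), coeFn_UFun M hM f,
      Lp.coeFn_smul z (UFun M hM f), h1] with t a b e h1
    simp only [RingHom.id_apply]
    rw [a, e, h1, Pi.smul_apply, Pi.smul_apply, b, smul_eq_mul, smul_eq_mul]
    ring
  norm_map' f := by
    show ‖UFun M hM f‖ = ‖f‖
    rw [Lp.norm_def, Lp.norm_def, eLpNorm_congr_ae (coeFn_UFun M hM f),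
      eLpNorm_comp_toEuclideanLin M hM (Lp.memLp f).1]

/-- The translation operator `(T_ℓ f)(t) = f(t - ℓ)` for `ℓ ∈ ℤ^d`. -/
def T (ℓ : Fin d → ℤ) : L2 d →ₗᵢ[ℂ] L2 d :=
  Lp.compMeasurePreservingₗᵢ ℂ (fun t : Rd d => t - WithLp.toLp 2 fun i => (ℓ i : ℝ))
    (measurePreserving_sub_right volume _)

theorem det_realMat (A : Matrix (Fin d) (Fin d) ℤ) : (realMat A).det = (A.det : ℝ) :=
  (Int.cast_det A).symm

/-- The dilation operator `D_A = U_A` associated with an integral matrix of determinant `±2`. -/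
def D (A : Matrix (Fin d) (Fin d) ℤ) (hA : |A.det| = 2) : L2 d ≃ₗᵢ[ℂ] L2 d :=
  U (realMat A) (by
    rw [det_realMat, Int.cast_ne_zero]
    intro h
    simp [h] at hA)

/-- The unitary Fourier transform on `L²(ℝ^d)` normalized as
`(ℱ f)(s) = (2π)^{-d/2} ∫ e^{-i s∘t} f(t) dt` for `f ∈ L¹ ∩ L²`. Mathlib's transform is
`(𝓕 f)(s) = ∫ e^{-2π i s∘t} f(t) dt`, so that `(ℱ f)(s) = (2π)^{-d/2} (𝓕 f)(s / 2π)`. -/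
def fourier (d : ℕ) : L2 d ≃ₗᵢ[ℂ] L2 d :=
  (Lp.fourierTransformₗᵢ (Rd d) ℂ).trans
    (U ((2 * Real.pi)⁻¹ • (1 : Matrix (Fin d) (Fin d) ℝ)) (by
      rw [det_smul, det_one, mul_one]
      exact pow_ne_zero _ (inv_ne_zero (by positivity))))

end UnitaryOperators

open Classical in
/-- The scaling function `φ = ℱ⁻¹ g`. (The value `0` is a placeholder for the case `g ∉ L²`, which
does not occur under the standing assumptions.) -/
def scalingFun {d : ℕ} (A : Matrix (Fin d) (Fin d) ℤ) (h : (Fin d → ℤ) →₀ ℂ) : L2 d :=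
  if hg : MemLp (gFun A h) 2 (volume : Measure (Rd d)) then (fourier d).symm (hg.toLp _) else 0

/-- The coefficient `⟨f, D_A^J T_ℓ φ⟩` (Mathlib's inner product is linear in its second slot). -/
def coeff {d : ℕ} (A : Matrix (Fin d) (Fin d) ℤ) (hA : |A.det| = 2) (h : (Fin d → ℤ) →₀ ℂ)
    (J : ℤ) (f : L2 d) (ℓ : Fin d → ℤ) : ℂ :=
  inner ℂ ((D A hA ^ J) (T ℓ (scalingFun A h))) f

/-- `L_J(f) = ∑_ℓ |⟨f, D_A^J T_ℓ φ⟩|²`. -/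
def LJ {d : ℕ} (A : Matrix (Fin d) (Fin d) ℤ) (hA : |A.det| = 2) (h : (Fin d → ℤ) →₀ ℂ)
    (J : ℤ) (f : L2 d) : ℝ :=
  ∑' ℓ : Fin d → ℤ, ‖coeff A hA h J f ℓ‖ ^ 2

end ParsevalWavelet

end

/-! In Mathlib's period-1 normalization, `φ = 𝓕⁻ G` with `G = symbol A h`, the product of `lowpass
h` along the contracting orbit of `(Aᵀ)⁻¹`. Everything rests on a Bessel bound for the integer
translates of `φ`. Lawton's first equation makes the subdivision operator an `ℓ²` isometry
(`sum_norm_sq_subdiv`). On the Fourier side, `n` subdivision steps multiply a trigonometric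
polynomial by the `n`-fold truncation of `G`, up to a dilation. By Parseval on the unit cube the
truncated integrals over `(Aᵀ)ⁿ cube` all equal `∑ |xₙ|²`, and Fatou yields `∫ |x̂ G|² ≤ ∑ |xₙ|²`
(`lintegral_trigPoly_mul_symbol_le`). This puts `G` in `L²` and, by duality
(`sum_norm_inner_sq_le_of_norm_sum_sq_le`), gives `L_J(f) ≤ ‖f‖²` for all `J`, since `D_A` is
unitary.

Consequently `√L_J` is 1-Lipschitz in `f`, uniformly in `J`, so both limits need checking only on
dense sets. As `J → +∞`, take `𝓕 f` of bounded support: the spectrum of `D_A^{-J} f` shrinks to the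
origin, where `G` is close to `1`, and Parseval on the cube gives a lower bound tending to `‖f‖²`
(`le_tsum_norm_inner_T_sq`). As `J → -∞`, take `f` of bounded support: the support of `D_A^{-J} f`
shrinks to the origin, so the coefficients see `φ` only on vanishing balls about lattice points, and
dominated convergence applies (`tendsto_tsum_norm_inner_T_sq_zero`). -/

noncomputable section

namespace ParsevalWavelet

open MeasureTheory Matrix
open scoped FourierTransform ENNReal

/-! ### Exponential decay of the powers of the inverse matrix. -/

section Decay

variable {d : ℕ}

attribute [local instance] Matrix.linftyOpNormedRing Matrix.linftyOpNormedAlgebra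

/-- Gelfand's formula: for `r` strictly between the spectral radius and `1`, eventually `‖aⁿ‖ ≤ rⁿ`;
the finitely many remaining powers are absorbed into `C`. -/
theorem exists_norm_pow_le_of_spectralRadius_lt_one {R : Type*} [NormedRing R] [NormedAlgebra ℂ R]
    [CompleteSpace R] (a : R) (ha : spectralRadius ℂ a < 1) :
    ∃ C r : ℝ, 0 < C ∧ 0 < r ∧ r < 1 ∧ ∀ n : ℕ, ‖a ^ n‖ ≤ C * r ^ n := by
  obtain ⟨r, hr1, hr2⟩ := ENNReal.lt_iff_exists_nnreal_btwn.mp ha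
  have hr0 : 0 < r := by
    have := hr1.bot_lt
    simpa using this
  have hr2' : r < 1 := by exact_mod_cast hr2
  have h1 := (spectrum.pow_nnnorm_pow_one_div_tendsto_nhds_spectralRadius a).eventually
    (gt_mem_nhds hr1)
  have h2 : (fun n : ℕ => a ^ n) =O[Filter.atTop] fun n : ℕ => (r : ℝ) ^ n := by
    refine Asymptotics.IsBigO.of_bound 1 ?_
    filter_upwards [h1, Filter.eventually_gt_atTop 0] with n hn hn0
    have h3 : ((‖a ^ n‖₊ : ℝ≥0∞) ^ (1 / n : ℝ)) ^ (n : ℝ) ≤ (r : ℝ≥0∞) ^ (n : ℝ) :=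
      ENNReal.rpow_le_rpow hn.le (by positivity)
    rw [← ENNReal.rpow_mul, one_div_mul_cancel (by positivity), ENNReal.rpow_one,
      ENNReal.rpow_natCast] at h3
    have h4 : ‖a ^ n‖₊ ≤ r ^ n := by exact_mod_cast h3
    have h5 : ‖a ^ n‖ ≤ (r : ℝ) ^ n := by exact_mod_cast h4
    simpa using h5
  obtain ⟨C, hC, hb⟩ := Asymptotics.bound_of_isBigO_nat_atTop h2
  refine ⟨C, r, hC, by exact_mod_cast hr0, by exact_mod_cast hr2', fun n => ?_⟩
  have h0 : (0 : ℝ) < r := by exact_mod_cast hr0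
  have := hb (x := n) (by positivity)
  simpa [abs_of_pos h0] using this

theorem norm_entry_le_linftyOpNorm (M : Matrix (Fin d) (Fin d) ℂ) (i j : Fin d) :
    ‖M i j‖ ≤ ‖M‖ := by
  rw [Matrix.linfty_opNorm_def]
  have h1 : ‖M i j‖₊ ≤ ∑ k, ‖M i k‖₊ :=
    Finset.single_le_sum (f := fun k => ‖M i k‖₊) (fun _ _ => zero_le) (Finset.mem_univ j)
  have h2 : (∑ k, ‖M i k‖₊) ≤ Finset.univ.sup fun i => ∑ k, ‖M i k‖₊ :=
    Finset.le_sup (f := fun i => ∑ k, ‖M i k‖₊) (Finset.mem_univ i)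
  exact_mod_cast h1.trans h2

theorem det_realMat_ne_zero {A : Matrix (Fin d) (Fin d) ℤ} (hA : |A.det| = 2) :
    (realMat A).det ≠ 0 := by
  rw [det_realMat, Int.cast_ne_zero]
  intro h
  simp [h] at hA

theorem spectralRadius_inv_lt_one {A : Matrix (Fin d) (Fin d) ℤ} (hexp : IsExpansive A)
    (hA : |A.det| = 2) :
    spectralRadius ℂ (A.map (Int.cast : ℤ → ℂ))⁻¹ < 1 := by
  -- An empty determinant is `1`, not `±2`. Nonempty indices make the matrix ring nontrivial, hence
  -- its spectrum nonempty, so strict bounds on spectral values pass to the supremum.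
  have hd : Nonempty (Fin d) := by
    by_contra h
    rw [not_nonempty_iff] at h
    simp [Matrix.det_isEmpty] at hA
  have : CompleteSpace (Matrix (Fin d) (Fin d) ℂ) := FiniteDimensional.complete ℂ _
  have hdet : IsUnit (A.map (Int.cast : ℤ → ℂ)).det := by
    have : (A.map (Int.cast : ℤ → ℂ)).det = (A.det : ℂ) := (Int.cast_det A).symm
    rw [this, isUnit_iff_ne_zero, Int.cast_ne_zero]
    intro h
    simp [h] at hA
  refine spectrum.spectralRadius_lt_of_forall_lt (r := 1) _ fun β hβ => ?_
  set u := Matrix.nonsingInvUnit _ hdet with hu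
  have h1 : (A.map (Int.cast : ℤ → ℂ))⁻¹ =
      ((u⁻¹ : (Matrix (Fin d) (Fin d) ℂ)ˣ) : Matrix _ _ ℂ) := by
    rw [Matrix.coe_units_inv]; rfl
  rw [h1] at hβ
  have hβ0 : β ≠ 0 := spectrum.ne_zero_of_mem_of_unit hβ
  have h2 := hexp β⁻¹ (by
    have := (spectrum.inv_mem_iff (r := Units.mk0 β hβ0) (a := u⁻¹)).mp hβ
    rwa [inv_inv, Units.val_inv_eq_inv_val] at this)
  have h3 : ‖β‖ < 1 := by
    rw [norm_inv] at h2
    by_contra! h4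
    exact absurd (inv_le_one_of_one_le₀ h4) (not_le.mpr h2)
  exact_mod_cast h3

theorem map_inv_realMat {A : Matrix (Fin d) (Fin d) ℤ} (hA : |A.det| = 2) :
    (realMat A)⁻¹.map (Complex.ofRealHom) = (A.map (Int.cast : ℤ → ℂ))⁻¹ := by
  symm
  apply Matrix.inv_eq_left_inv
  have h1 : A.map (Int.cast : ℤ → ℂ) = (realMat A).map Complex.ofRealHom := by
    ext i j; simp [realMat]
  rw [h1, ← Matrix.map_mul, Matrix.nonsing_inv_mul _ (det_realMat_ne_zero hA).isUnit]
  simp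

theorem exists_entry_le {A : Matrix (Fin d) (Fin d) ℤ} (hexp : IsExpansive A) (hA : |A.det| = 2) :
    ∃ C r : ℝ, 0 < C ∧ 0 < r ∧ r < 1 ∧ ∀ (n : ℕ) (i j), |((realMat A)⁻¹ ^ n) i j| ≤ C * r ^ n := by
  have : CompleteSpace (Matrix (Fin d) (Fin d) ℂ) := FiniteDimensional.complete ℂ _
  obtain ⟨C, r, hC, hr0, hr1, h⟩ :=
    exists_norm_pow_le_of_spectralRadius_lt_one _ (spectralRadius_inv_lt_one hexp hA)
  refine ⟨C, r, hC, hr0, hr1, fun n i j => ?_⟩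
  have h1 : ((A.map (Int.cast : ℤ → ℂ))⁻¹ ^ n) i j = ((((realMat A)⁻¹ ^ n) i j : ℝ) : ℂ) := by
    rw [← map_inv_realMat hA, ← RingHom.mapMatrix_apply, ← map_pow]
    simp
  have h2 := (norm_entry_le_linftyOpNorm _ i j).trans (h n)
  rwa [h1, Complex.norm_real, Real.norm_eq_abs] at h2

end Decay

theorem norm_toEuclideanLin_le {d : ℕ} (M : Matrix (Fin d) (Fin d) ℝ) {c : ℝ} (hc : 0 ≤ c)
    (hM : ∀ i j, |M i j| ≤ c) (x : Rd d) : ‖toEuclideanLin M x‖ ≤ d * d * c * ‖x‖ := by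
  have h1 : ∀ i, ‖(toEuclideanLin M x) i‖ ≤ d * c * ‖x‖ := by
    intro i
    have h2 : (toEuclideanLin M x) i = ∑ j, M i j * x j := by
      simp [toLpLin_apply, mulVec, dotProduct]
    rw [h2]
    calc ‖∑ j, M i j * x j‖ ≤ ∑ j, ‖M i j * x j‖ := norm_sum_le _ _
      _ ≤ ∑ _j : Fin d, c * ‖x‖ := by
        refine Finset.sum_le_sum fun j _ => ?_
        rw [norm_mul]
        exact mul_le_mul (hM i j) (PiLp.norm_apply_le x j) (norm_nonneg _) hc
      _ = d * c * ‖x‖ := by simp [mul_assoc]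
  have h3 : ‖toEuclideanLin M x‖ ≤ ∑ i, ‖(toEuclideanLin M x) i‖ := by
    rw [EuclideanSpace.norm_eq]
    refine Real.sqrt_le_iff.mpr ⟨by positivity, ?_⟩
    exact Finset.sum_sq_le_sq_sum_of_nonneg fun _ _ => norm_nonneg _
  refine h3.trans ((Finset.sum_le_sum fun i _ => h1 i).trans (le_of_eq ?_))
  simp [mul_assoc]

/-- For expansive `A`, the powers of `A⁻¹` and of `(Aᵀ)⁻¹` decay exponentially. -/
theorem exists_decay {d : ℕ} {A : Matrix (Fin d) (Fin d) ℤ} (hexp : IsExpansive A)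
    (hA : |A.det| = 2) :
    ∃ C r : ℝ, 0 < C ∧ 0 < r ∧ r < 1 ∧ ∀ (n : ℕ) (x : Rd d),
      ‖toEuclideanLin ((realMat A)⁻¹ ^ n) x‖ ≤ C * r ^ n * ‖x‖ ∧
      ‖toEuclideanLin ((realMat A)ᵀ⁻¹ ^ n) x‖ ≤ C * r ^ n * ‖x‖ := by
  obtain ⟨C, r, hC, hr0, hr1, h⟩ := exists_entry_le hexp hA
  -- The `+ 1` makes the constant positive without using `d ≠ 0`.
  refine ⟨d * d * C + 1, r, by positivity, hr0, hr1, fun n x => ?_⟩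
  have h0 : (d * d * (C * r ^ n)) * ‖x‖ ≤ (d * d * C + 1) * r ^ n * ‖x‖ := by
    refine mul_le_mul_of_nonneg_right ?_ (norm_nonneg x)
    nlinarith [pow_pos hr0 n]
  refine ⟨(norm_toEuclideanLin_le _ (by positivity) (h n) x).trans h0,
    (norm_toEuclideanLin_le _ (by positivity) (fun i j => ?_) x).trans h0⟩
  rw [← Matrix.transpose_nonsing_inv, ← Matrix.transpose_pow]
  exact h n j i

/-! ### Trigonometric polynomials and the filter with period 1. -/

section TrigPoly

variable {d : ℕ}

/-- The character `e^{-2πi n∘s}` of `ℝ^d`. -/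
def expo (n : Fin d → ℤ) (s : Rd d) : ℂ :=
  Complex.exp (Complex.I * ((-(2 * Real.pi * ∑ i, (n i : ℝ) * s i) : ℝ) : ℂ))

@[simp]
theorem norm_expo (n : Fin d → ℤ) (s : Rd d) : ‖expo n s‖ = 1 := by
  rw [expo, mul_comm, Complex.norm_exp_ofReal_mul_I]

theorem expo_add (n m : Fin d → ℤ) (s : Rd d) : expo (n + m) s = expo n s * expo m s := by
  rw [expo, expo, expo, ← Complex.exp_add, ← mul_add, ← Complex.ofReal_add]
  congr 3
  simp only [Pi.add_apply, Int.cast_add, add_mul, Finset.sum_add_distrib]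
  ring

theorem expo_neg (n : Fin d → ℤ) (s : Rd d) : expo (-n) s = starRingEnd ℂ (expo n s) := by
  rw [expo, expo, ← Complex.exp_conj, map_mul, Complex.conj_I, Complex.conj_ofReal]
  congr 1
  simp

theorem expo_apply_transpose (A : Matrix (Fin d) (Fin d) ℤ) (n : Fin d → ℤ) (s : Rd d) :
    expo n (toEuclideanLin (realMat A)ᵀ s) = expo (A *ᵥ n) s := by
  rw [expo, expo]
  congr 5
  simp only [toLpLin_apply, mulVec, dotProduct, realMat, transpose_apply, map_apply,
    Int.cast_sum, Int.cast_mul, Finset.mul_sum, Finset.sum_mul]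
  rw [Finset.sum_comm]
  refine Finset.sum_congr rfl fun i _ => Finset.sum_congr rfl fun j _ => by ring

@[fun_prop]
theorem continuous_expo (n : Fin d → ℤ) : Continuous (expo n) := by
  unfold expo
  fun_prop

theorem norm_expo_sub_one_le (n : Fin d → ℤ) (s : Rd d) :
    ‖expo n s - 1‖ ≤ 2 * Real.pi * (∑ i, |(n i : ℝ)|) * ‖s‖ := by
  refine Real.norm_exp_I_mul_ofReal_sub_one_le.trans ?_
  rw [norm_neg, norm_mul, Real.norm_of_nonneg (by positivity), mul_assoc (2 * Real.pi)]
  refine mul_le_mul_of_nonneg_left ?_ (by positivity)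
  refine (norm_sum_le Finset.univ fun i => (n i : ℝ) * s i).trans ?_
  rw [Finset.sum_mul]
  refine Finset.sum_le_sum fun i _ => ?_
  rw [norm_mul, Real.norm_eq_abs]
  gcongr
  exact PiLp.norm_apply_le s i

/-- The trigonometric polynomial `∑ₙ xₙ e^{-2πi n∘s}`. -/
def trigPoly (x : (Fin d → ℤ) →₀ ℂ) (s : Rd d) : ℂ :=
  Finsupp.linearCombination ℂ (fun n => expo n s) x

@[fun_prop]
theorem continuous_trigPoly (x : (Fin d → ℤ) →₀ ℂ) : Continuous (trigPoly x) := by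
  unfold trigPoly
  simp only [Finsupp.linearCombination_apply, Finsupp.sum]
  fun_prop

/-- The filter function in the normalization with period `1`. -/
def lowpass (h : (Fin d → ℤ) →₀ ℂ) (s : Rd d) : ℂ :=
  (1 / (Real.sqrt 2 : ℂ)) * trigPoly h s

@[fun_prop]
theorem continuous_lowpass (h : (Fin d → ℤ) →₀ ℂ) : Continuous (lowpass h) := by
  unfold lowpass
  fun_prop

theorem filterFun_two_pi_smul (h : (Fin d → ℤ) →₀ ℂ) (s : Rd d) :
    filterFun h ((2 * Real.pi) • s) = lowpass h s := by
  simp only [filterFun, lowpass, trigPoly, Finsupp.linearCombination_apply, expo, Finsupp.sum,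
    smul_eq_mul]
  congr 1
  refine Finset.sum_congr rfl fun n _ => ?_
  congr 2
  simp only [PiLp.smul_apply, smul_eq_mul, Complex.ofReal_neg, Finset.mul_sum, neg_mul, mul_neg]
  congr 3
  exact Finset.sum_congr rfl fun i _ => by ring

theorem trigPoly_zero_right (x : (Fin d → ℤ) →₀ ℂ) : trigPoly x 0 = x.sum fun _ c => c := by
  simp [trigPoly, Finsupp.linearCombination_apply, expo]

theorem exists_norm_trigPoly_sub_le (x : (Fin d → ℤ) →₀ ℂ) :
    ∃ K : ℝ, 0 ≤ K ∧ ∀ s, ‖trigPoly x s - trigPoly x 0‖ ≤ K * ‖s‖ := by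
  refine ⟨∑ n ∈ x.support, ‖x n‖ * (2 * Real.pi * ∑ i, |(n i : ℝ)|), by positivity, fun s => ?_⟩
  rw [trigPoly_zero_right]
  simp only [trigPoly, Finsupp.linearCombination_apply, Finsupp.sum]
  rw [← Finset.sum_sub_distrib, Finset.sum_mul]
  refine (norm_sum_le _ _).trans (Finset.sum_le_sum fun n _ => ?_)
  have : x n • expo n s - x n = x n * (expo n s - 1) := by
    rw [smul_eq_mul]; ring
  rw [this, norm_mul, mul_assoc]
  gcongr
  exact norm_expo_sub_one_le n s

/-- Lawton's second equation says exactly that the filter equals `1` at the origin; a trigonometric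
polynomial differs from its value there by at most a multiple of `‖s‖`. -/
theorem exists_norm_lowpass_sub_one_le {A : Matrix (Fin d) (Fin d) ℤ} {h : (Fin d → ℤ) →₀ ℂ}
    (hh : IsLawtonSolution A h) : ∃ K : ℝ, 0 ≤ K ∧ ∀ s, ‖lowpass h s - 1‖ ≤ K * ‖s‖ := by
  obtain ⟨K, hK, hb⟩ := exists_norm_trigPoly_sub_le h
  refine ⟨‖(1 / (Real.sqrt 2 : ℂ))‖ * K, by positivity, fun s => ?_⟩
  have h0 : (1 / (Real.sqrt 2 : ℂ)) * trigPoly h 0 = 1 := by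
    rw [trigPoly_zero_right, hh.2, one_div, inv_mul_cancel₀]
    simp
  have h1 : lowpass h s - 1 = (1 / (Real.sqrt 2 : ℂ)) * (trigPoly h s - trigPoly h 0) := by
    rw [mul_sub, h0, lowpass]
  rw [h1, norm_mul, mul_assoc]
  gcongr
  exact hb s

end TrigPoly

/-! ### The subdivision operator as an `ℓ²` isometry. -/

section Subdivision

variable {d : ℕ}

/-- The subdivision operator: `(S x)ₖ = ∑ₘ xₘ h_{k - A m}`. -/
def subdiv (A : Matrix (Fin d) (Fin d) ℤ) (h x : (Fin d → ℤ) →₀ ℂ) : (Fin d → ℤ) →₀ ℂ :=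
  Finsupp.linearCombination ℂ (fun m => h.mapDomain fun n => n + A *ᵥ m) x

theorem linearCombination_subdiv {V : Type*} [AddCommGroup V] [Module ℂ V]
    (A : Matrix (Fin d) (Fin d) ℤ) (h x : (Fin d → ℤ) →₀ ℂ) (v : (Fin d → ℤ) → V) :
    Finsupp.linearCombination ℂ v (subdiv A h x) =
      Finsupp.linearCombination ℂ
        (fun m => Finsupp.linearCombination ℂ v (h.mapDomain fun n => n + A *ᵥ m)) x := by
  simp only [subdiv, Finsupp.linearCombination_apply ℂ x, Finsupp.sum, map_sum, map_smul]

theorem trigPoly_subdiv (A : Matrix (Fin d) (Fin d) ℤ) (h x : (Fin d → ℤ) →₀ ℂ) (s : Rd d) :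
    trigPoly (subdiv A h x) s = trigPoly x (toEuclideanLin (realMat A)ᵀ s) * trigPoly h s := by
  rw [trigPoly, linearCombination_subdiv]
  simp only [Finsupp.linearCombination_mapDomain, trigPoly, expo_apply_transpose]
  simp only [Finsupp.linearCombination_apply, Finsupp.sum, Finset.sum_mul, Function.comp_apply,
    expo_add, smul_eq_mul, Finset.mul_sum]
  rw [Finset.sum_comm]
  refine Finset.sum_congr rfl fun m _ => Finset.sum_congr rfl fun n _ => by ring

/-- The inner product of the copies shifted by `A m` and `A m'` is the conjugate of Lawton's sum at
`k = A (m - m')`, and injectivity of `A` turns `k = 0` into `m = m'`. -/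
theorem orthonormal_linearCombination_shift {H : Type*} [NormedAddCommGroup H]
    [InnerProductSpace ℂ H] {v : (Fin d → ℤ) → H} (hv : Orthonormal ℂ v)
    {A : Matrix (Fin d) (Fin d) ℤ} (hA : A.det ≠ 0) {h : (Fin d → ℤ) →₀ ℂ}
    (hh : IsLawtonSolution A h) :
    Orthonormal ℂ fun m =>
      Finsupp.linearCombination ℂ v (h.mapDomain fun n => n + A *ᵥ m) := by
  classical
  rw [orthonormal_iff_ite]
  intro m m'
  rw [hv.inner_finsupp_eq_sum_left, Finsupp.sum_mapDomain_index_inj (add_left_injective _)]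
  have h1 : ∀ n, (h.mapDomain fun n => n + A *ᵥ m') (n + A *ᵥ m) = h (n + A *ᵥ (m - m')) := by
    intro n
    have : n + A *ᵥ m = (n + A *ᵥ (m - m')) + A *ᵥ m' := by
      rw [mulVec_sub]; abel
    rw [this]
    exact Finsupp.mapDomain_apply (add_left_injective (A *ᵥ m')) h _
  simp only [h1]
  have h2 := congrArg (starRingEnd ℂ) (hh.1 (A *ᵥ (m - m')) ⟨_, rfl⟩)
  rw [Finsupp.sum, map_sum] at h2
  simp only [map_mul, Complex.conj_conj] at h2
  rw [Finsupp.sum, h2]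
  have h3 : A *ᵥ (m - m') = 0 ↔ m = m' :=
    ⟨fun h => sub_eq_zero.mp (Matrix.eq_zero_of_mulVec_eq_zero hA h), fun h => by simp [h]⟩
  simp only [h3]
  split_ifs <;> simp

theorem norm_sq_linearCombination_of_orthonormal {ι H : Type*} [NormedAddCommGroup H]
    [InnerProductSpace ℂ H] {v : ι → H} (hv : Orthonormal ℂ v) (x : ι →₀ ℂ) :
    ‖Finsupp.linearCombination ℂ v x‖ ^ 2 = x.sum fun _ c => ‖c‖ ^ 2 := by
  have h1 := inner_self_eq_norm_sq_to_K (𝕜 := ℂ) (Finsupp.linearCombination ℂ v x)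
  rw [hv.inner_finsupp_eq_sum_left] at h1
  have h2 : ((x.sum fun _ c => ‖c‖ ^ 2 : ℝ) : ℂ) = x.sum fun i y => (starRingEnd ℂ) y * x i := by
    rw [Finsupp.sum, Finsupp.sum, Complex.ofReal_sum]
    refine Finset.sum_congr rfl fun i _ => ?_
    rw [Complex.conj_mul']
    simp
  rw [← h2] at h1
  apply Complex.ofReal_injective
  rw [h1]
  simp

theorem sum_norm_sq_subdiv {A : Matrix (Fin d) (Fin d) ℤ} (hA : A.det ≠ 0)
    {h : (Fin d → ℤ) →₀ ℂ} (hh : IsLawtonSolution A h) (x : (Fin d → ℤ) →₀ ℂ) :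
    ((subdiv A h x).sum fun _ c => ‖c‖ ^ 2) = x.sum fun _ c => ‖c‖ ^ 2 := by
  -- Any orthonormal family indexed by `ℤ^d` would do; it only realizes `ℓ²` norms as Hilbert space
  -- norms.
  have hv := (UnitAddTorus.orthonormal_mFourier (d := Fin d))
  rw [← norm_sq_linearCombination_of_orthonormal hv, linearCombination_subdiv,
    norm_sq_linearCombination_of_orthonormal (orthonormal_linearCombination_shift hv hA hh)]

theorem sum_norm_sq_iterate_subdiv {A : Matrix (Fin d) (Fin d) ℤ} (hA : A.det ≠ 0)
    {h : (Fin d → ℤ) →₀ ℂ} (hh : IsLawtonSolution A h) (n : ℕ) (x : (Fin d → ℤ) →₀ ℂ) :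
    (((subdiv A h)^[n] x).sum fun _ c => ‖c‖ ^ 2) = x.sum fun _ c => ‖c‖ ^ 2 := by
  induction n with
  | zero => rfl
  | succ n ih => rw [Function.iterate_succ_apply', sum_norm_sq_subdiv hA hh, ih]

theorem toEuclideanLin_mul_apply (M N : Matrix (Fin d) (Fin d) ℝ) (s : Rd d) :
    toEuclideanLin M (toEuclideanLin N s) = toEuclideanLin (M * N) s := by
  ext i
  simp [toLpLin_apply, mulVec_mulVec]

theorem toEuclideanLin_one_apply (s : Rd d) :
    toEuclideanLin (1 : Matrix (Fin d) (Fin d) ℝ) s = s := by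
  ext i
  simp

theorem trigPoly_iterate_subdiv (A : Matrix (Fin d) (Fin d) ℤ) (h : (Fin d → ℤ) →₀ ℂ) (n : ℕ)
    (x : (Fin d → ℤ) →₀ ℂ) (s : Rd d) :
    trigPoly ((subdiv A h)^[n] x) s = trigPoly x (toEuclideanLin ((realMat A)ᵀ ^ n) s) *
      ∏ j ∈ Finset.range n, trigPoly h (toEuclideanLin ((realMat A)ᵀ ^ j) s) := by
  induction n generalizing x with
  | zero => simp
  | succ n ih =>
    rw [Function.iterate_succ_apply, ih, trigPoly_subdiv, toEuclideanLin_mul_apply, ← pow_succ',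
      Finset.prod_range_succ]
    ring

end Subdivision

/-! ### Convergence of the infinite product and its behaviour at the origin. -/

section Symbol

variable {d : ℕ}

/-- The infinite product `∏_{j ≥ 1} m₀((Aᵀ)^{-j} s)` for the filter function with period `1`. -/
def symbol (A : Matrix (Fin d) (Fin d) ℤ) (h : (Fin d → ℤ) →₀ ℂ) (s : Rd d) : ℂ :=
  ∏' j : ℕ, lowpass h (toEuclideanLin ((realMat A)ᵀ⁻¹ ^ (j + 1)) s)

theorem factor_two_pi_smul (A : Matrix (Fin d) (Fin d) ℤ) (h : (Fin d → ℤ) →₀ ℂ) (s : Rd d)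
    (j : ℕ) : factor A h ((2 * Real.pi) • s) j =
      lowpass h (toEuclideanLin ((realMat A)ᵀ⁻¹ ^ j) s) := by
  rw [factor, map_smul, filterFun_two_pi_smul]

variable {A : Matrix (Fin d) (Fin d) ℤ} {h : (Fin d → ℤ) →₀ ℂ}

/-- The Lipschitz bound at the origin, applied along an exponentially contracting orbit, is
dominated by a geometric series, with total linear in `‖s‖`. -/
theorem exists_summable_norm_lowpass_sub_one (hexp : IsExpansive A) (hA : |A.det| = 2)
    (hh : IsLawtonSolution A h) :
    ∃ K : ℝ, 0 ≤ K ∧ ∀ s : Rd d,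
      Summable (fun j : ℕ => ‖lowpass h (toEuclideanLin ((realMat A)ᵀ⁻¹ ^ (j + 1)) s) - 1‖) ∧
      ∑' j : ℕ, ‖lowpass h (toEuclideanLin ((realMat A)ᵀ⁻¹ ^ (j + 1)) s) - 1‖ ≤ K * ‖s‖ := by
  obtain ⟨K, hK, hb⟩ := exists_norm_lowpass_sub_one_le hh
  obtain ⟨C, r, hC, hr0, hr1, hd⟩ := exists_decay hexp hA
  have hs : Summable fun j : ℕ => r ^ (j + 1) :=
    (summable_nat_add_iff 1).mpr (summable_geometric_of_lt_one hr0.le hr1)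
  refine ⟨K * C * ∑' j : ℕ, r ^ (j + 1), by positivity, fun s => ?_⟩
  have hle : ∀ j : ℕ, ‖lowpass h (toEuclideanLin ((realMat A)ᵀ⁻¹ ^ (j + 1)) s) - 1‖ ≤
      (K * C * ‖s‖) * r ^ (j + 1) := fun j =>
    (hb _).trans ((mul_le_mul_of_nonneg_left (hd (j + 1) s).2 hK).trans (le_of_eq (by ring)))
  have hsum := Summable.of_nonneg_of_le (fun j => norm_nonneg _) hle (hs.mul_left (K * C * ‖s‖))
  refine ⟨hsum, (hsum.tsum_le_tsum hle (hs.mul_left _)).trans (le_of_eq ?_)⟩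
  rw [tsum_mul_left]
  ring

theorem multipliable_lowpass (hexp : IsExpansive A) (hA : |A.det| = 2)
    (hh : IsLawtonSolution A h) (s : Rd d) :
    Multipliable fun j : ℕ => lowpass h (toEuclideanLin ((realMat A)ᵀ⁻¹ ^ (j + 1)) s) := by
  obtain ⟨K, -, hb⟩ := exists_summable_norm_lowpass_sub_one hexp hA hh
  simpa using multipliable_one_add_of_summable (hb s).1

theorem tendsto_prod_lowpass (hexp : IsExpansive A) (hA : |A.det| = 2)
    (hh : IsLawtonSolution A h) (s : Rd d) :
    Filter.Tendsto (fun n => ∏ j ∈ Finset.range n,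
      lowpass h (toEuclideanLin ((realMat A)ᵀ⁻¹ ^ (j + 1)) s)) Filter.atTop
      (nhds (symbol A h s)) :=
  (multipliable_lowpass hexp hA hh s).tendsto_prod_tprod_nat

/-- The bound `‖∏ (1 + aⱼ) - 1‖ ≤ exp (∑ ‖aⱼ‖) - 1` survives the limit. It makes the symbol
uniformly close to `1` on small balls, which drives the limit at `+∞`. -/
theorem exists_norm_symbol_sub_one_le (hexp : IsExpansive A) (hA : |A.det| = 2)
    (hh : IsLawtonSolution A h) :
    ∃ K : ℝ, 0 ≤ K ∧ ∀ s : Rd d, ‖symbol A h s - 1‖ ≤ Real.exp (K * ‖s‖) - 1 := by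
  obtain ⟨K, hK, hb⟩ := exists_summable_norm_lowpass_sub_one hexp hA hh
  refine ⟨K, hK, fun s => ?_⟩
  refine le_of_tendsto ((tendsto_prod_lowpass hexp hA hh s).sub_const 1).norm
    (Filter.Eventually.of_forall fun n => ?_)
  have h1 := Finset.norm_prod_one_add_sub_one_le (Finset.range n)
    fun j => lowpass h (toEuclideanLin ((realMat A)ᵀ⁻¹ ^ (j + 1)) s) - 1
  simp only [add_sub_cancel] at h1
  refine h1.trans (sub_le_sub_right (Real.exp_le_exp.mpr ?_) _)
  exact ((hb s).1.sum_le_tsum _ fun _ _ => norm_nonneg _).trans (hb s).2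

theorem measurable_symbol (hexp : IsExpansive A) (hA : |A.det| = 2)
    (hh : IsLawtonSolution A h) : Measurable (symbol A h) := by
  refine measurable_of_tendsto_metrizable (f := fun n s => ∏ j ∈ Finset.range n,
      lowpass h (toEuclideanLin ((realMat A)ᵀ⁻¹ ^ (j + 1)) s)) (fun n => ?_)
    (tendsto_pi_nhds.mpr fun s => tendsto_prod_lowpass hexp hA hh s)
  exact Finset.measurable_prod _ fun j _ =>
    (continuous_lowpass h).measurable.comp (measurable_toEuclideanLin _)

end Symbol

/-! ### Parseval on the unit cube, transported from the torus. -/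

section Cube

variable {d : ℕ}

/-- The normalized Haar measure on `ℝ / ℤ`, as in the theory of multivariate Fourier series. -/
local instance : MeasureSpace UnitAddCircle := ⟨AddCircle.haarAddCircle⟩

local instance : IsProbabilityMeasure (volume : Measure UnitAddCircle) :=
  inferInstanceAs (IsProbabilityMeasure AddCircle.haarAddCircle)

/-- The half-open unit cube centred at the origin. -/
def cube (d : ℕ) : Set (Rd d) := {s | ∀ i, s i ∈ Set.Ioc (-1 / 2 : ℝ) (-1 / 2 + 1)}

theorem measurableSet_cube : MeasurableSet (cube d) := by
  have : cube d = ⋂ i, (fun s : Rd d => s i) ⁻¹' Set.Ioc (-1 / 2 : ℝ) (-1 / 2 + 1) := by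
    ext s; simp [cube]
  rw [this]
  exact MeasurableSet.iInter fun i => measurableSet_Ioc.preimage (by fun_prop)

theorem mem_cube_of_norm_lt {s : Rd d} (hs : ‖s‖ < 1 / 2) : s ∈ cube d := by
  intro i
  have h1 := (PiLp.norm_apply_le s i).trans_lt hs
  rw [Real.norm_eq_abs, abs_lt] at h1
  exact ⟨by linarith [h1.1], by linarith [h1.2]⟩

/-- The section of the covering `ℝ^d → (ℝ/ℤ)^d` with values in the unit cube. -/
def cubeSection (y : UnitAddTorus (Fin d)) : Rd d :=
  WithLp.toLp 2 (UnitAddTorus.measurableEquivPiIoc (fun _ => (-1 / 2 : ℝ)) y).1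

theorem measurableSet_piIoc :
    MeasurableSet {x : Fin d → ℝ | ∀ i, x i ∈ Set.Ioc (-1 / 2 : ℝ) (-1 / 2 + 1)} :=
  MeasurableSet.univ_pi' fun _ => measurableSet_Ioc

theorem measurableEmbedding_cubeSection : MeasurableEmbedding (cubeSection (d := d)) :=
  (MeasurableEquiv.toLp 2 (Fin d → ℝ)).measurableEmbedding.comp
    ((MeasurableEmbedding.subtype_coe measurableSet_piIoc).comp
      (UnitAddTorus.measurableEquivPiIoc fun _ => (-1 / 2 : ℝ)).measurableEmbedding)

theorem measurePreserving_cubeSection :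
    MeasurePreserving (cubeSection (d := d)) volume (volume.restrict (cube d)) := by
  have h1 := UnitAddTorus.measurePreserving_equivPiIoc fun _ : Fin d => (-1 / 2 : ℝ)
  have h2 : MeasurePreserving
      (Subtype.val : {x : Fin d → ℝ // ∀ i, x i ∈ Set.Ioc (-1 / 2 : ℝ) (-1 / 2 + 1)} → _)
      (Measure.comap Subtype.val volume)
      (volume.restrict {x : Fin d → ℝ | ∀ i, x i ∈ Set.Ioc (-1 / 2 : ℝ) (-1 / 2 + 1)}) :=
    ⟨measurable_subtype_coe, map_comap_subtype_coe measurableSet_piIoc volume⟩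
  have h3 := (EuclideanSpace.volume_preserving_symm_measurableEquiv_toLp (Fin d)).symm
    |>.restrict_preimage (measurableSet_cube (d := d))
  exact h3.comp (h2.comp h1)

theorem mFourier_eq_expo (n : Fin d → ℤ) (y : UnitAddTorus (Fin d)) :
    UnitAddTorus.mFourier (-n) y = expo n (cubeSection y) := by
  have hy : ∀ i, y i = (((cubeSection y) i : ℝ) : UnitAddCircle) := fun i =>
    ((AddCircle.equivIoc (1 : ℝ) (-1 / 2)).symm_apply_apply (y i)).symm
  simp only [UnitAddTorus.mFourier, ContinuousMap.coe_mk]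
  rw [Finset.prod_congr rfl fun i _ => by rw [hy i, fourier_coe_apply], ← Complex.exp_sum, expo]
  congr 1
  simp only [Complex.ofReal_neg, Complex.ofReal_mul, Complex.ofReal_sum, Finset.mul_sum,
    ← Finset.sum_neg_distrib, Pi.neg_apply]
  refine Finset.sum_congr rfl fun i _ => ?_
  push_cast
  ring

/-- Parseval on the torus, pulled through the measure-preserving section onto the cube. -/
theorem hasSum_norm_sq_integral_expo {u : Rd d → ℂ}
    (hu : MemLp u 2 (volume.restrict (cube d))) :
    HasSum (fun n : Fin d → ℤ => ‖∫ s in cube d, expo n s * u s‖ ^ 2)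
      (∫ s in cube d, ‖u s‖ ^ 2) := by
  have hu' := hu.comp_measurePreserving measurePreserving_cubeSection
  have h1 := UnitAddTorus.hasSum_sq_mFourierCoeff hu'.toLp
  rw [← measurePreserving_cubeSection.integral_comp measurableEmbedding_cubeSection]
  have h2 : ∫ t, ‖(hu'.toLp) t‖ ^ 2 = ∫ y, ‖u (cubeSection y)‖ ^ 2 := by
    refine integral_congr_ae ?_
    filter_upwards [hu'.coeFn_toLp] with y hy
    rw [hy, Function.comp_apply]
  rw [h2] at h1
  refine h1.congr_fun fun n => ?_
  rw [← measurePreserving_cubeSection.integral_comp measurableEmbedding_cubeSection,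
    UnitAddTorus.mFourierCoeff]
  congr 2
  refine integral_congr_ae ?_
  filter_upwards [hu'.coeFn_toLp] with y hy
  rw [hy, Function.comp_apply, mFourier_eq_expo, smul_eq_mul]

theorem lintegral_cube_trigPoly (x : (Fin d → ℤ) →₀ ℂ) :
    ∫⁻ s in cube d, ‖trigPoly x s‖ₑ ^ 2 = ENNReal.ofReal (x.sum fun _ c => ‖c‖ ^ 2) := by
  have hv : Orthonormal ℂ fun n : Fin d → ℤ => UnitAddTorus.mFourierLp 2 (-n) :=
    UnitAddTorus.orthonormal_mFourier.comp _ neg_injective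
  rw [← norm_sq_linearCombination_of_orthonormal hv]
  set F : C(UnitAddTorus (Fin d), ℂ) :=
    Finsupp.linearCombination ℂ (fun n => UnitAddTorus.mFourier (-n)) x with hF
  have h1 : Finsupp.linearCombination ℂ (fun n : Fin d → ℤ => UnitAddTorus.mFourierLp 2 (-n)) x =
      ContinuousMap.toLp (E := ℂ) 2 volume ℂ F := by
    simp [hF, Finsupp.linearCombination_apply, Finsupp.sum, map_sum]
  have h2 : ∀ y, F y = trigPoly x (cubeSection y) := by
    intro y
    simp [hF, trigPoly, Finsupp.linearCombination_apply, Finsupp.sum, mFourier_eq_expo]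
  rw [h1, ← measurePreserving_cubeSection.lintegral_comp
    ((continuous_trigPoly x).measurable.enorm.pow_const 2), Lp.norm_def, ← ENNReal.toReal_pow,
    ENNReal.ofReal_toReal (ENNReal.pow_ne_top (Lp.eLpNorm_ne_top _)),
    eLpNorm_congr_ae (ContinuousMap.coeFn_toLp volume F),
    eLpNorm_eq_lintegral_rpow_enorm_toReal (by simp) (by simp)]
  simp only [ENNReal.toReal_ofNat, h2, ENNReal.rpow_ofNat]
  rw [← ENNReal.rpow_natCast, ← ENNReal.rpow_mul]
  simp

end Cube

/-! ### Truncated products, Fatou and the Bessel bound in frequency. -/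

section Truncation

variable {d : ℕ} {A : Matrix (Fin d) (Fin d) ℤ} {h : (Fin d → ℤ) →₀ ℂ}

theorem lintegral_comp_toEuclideanLin (M : Matrix (Fin d) (Fin d) ℝ) (hM : M.det ≠ 0)
    {f : Rd d → ℝ≥0∞} (hf : Measurable f) :
    ∫⁻ s, f (toEuclideanLin M s) = ENNReal.ofReal |M.det⁻¹| * ∫⁻ s, f s := by
  rw [← lintegral_map hf (measurable_toEuclideanLin M), map_toEuclideanLin M hM,
    lintegral_smul_measure, smul_eq_mul]

theorem abs_det_transpose_inv_pow (hA : |A.det| = 2) (n : ℕ) :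
    |((realMat A)ᵀ⁻¹ ^ n).det| = (1 / 2) ^ n := by
  rw [det_pow, det_nonsing_inv, det_transpose, det_realMat, abs_pow, Ring.inverse_eq_inv, abs_inv,
    ← Int.cast_abs, hA]
  norm_num

theorem transpose_pow_mul_inv_pow (hA : |A.det| = 2) {j n : ℕ} (hj : j ≤ n) :
    (realMat A)ᵀ ^ j * (realMat A)ᵀ⁻¹ ^ n = (realMat A)ᵀ⁻¹ ^ (n - j) := by
  have hu : IsUnit (realMat A)ᵀ.det := by
    rw [det_transpose]; exact (det_realMat_ne_zero hA).isUnit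
  obtain ⟨k, rfl⟩ := Nat.exists_eq_add_of_le hj
  rw [pow_add, ← mul_assoc, ← Commute.mul_pow, mul_nonsing_inv _ hu, one_pow, one_mul,
    Nat.add_sub_cancel_left]
  rw [Commute, SemiconjBy, mul_nonsing_inv _ hu, nonsing_inv_mul _ hu]

theorem trigPoly_eq_sqrt_two_mul_lowpass (h : (Fin d → ℤ) →₀ ℂ) (s : Rd d) :
    trigPoly h s = (Real.sqrt 2 : ℂ) * lowpass h s := by
  rw [lowpass, ← mul_assoc, mul_one_div_cancel, one_mul]
  simp

/-- Evaluating at `(Aᵀ)⁻ⁿ s` turns the forward orbit of the iterates into the backward orbit in the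
product defining the symbol, read in reverse order; each factor `trigPoly h` contributes one `√2`
over `lowpass h`. -/
theorem trigPoly_iterate_subdiv_inv_pow (hA : |A.det| = 2) (n : ℕ) (x : (Fin d → ℤ) →₀ ℂ)
    (s : Rd d) :
    trigPoly ((subdiv A h)^[n] x) (toEuclideanLin ((realMat A)ᵀ⁻¹ ^ n) s) =
      (Real.sqrt 2 : ℂ) ^ n * (trigPoly x s * ∏ j ∈ Finset.range n,
        lowpass h (toEuclideanLin ((realMat A)ᵀ⁻¹ ^ (j + 1)) s)) := by
  rw [trigPoly_iterate_subdiv, toEuclideanLin_mul_apply, transpose_pow_mul_inv_pow hA le_rfl,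
    Nat.sub_self, pow_zero, toEuclideanLin_one_apply]
  have h1 : ∏ j ∈ Finset.range n, trigPoly h (toEuclideanLin ((realMat A)ᵀ ^ j)
      (toEuclideanLin ((realMat A)ᵀ⁻¹ ^ n) s)) = ∏ j ∈ Finset.range n,
      ((Real.sqrt 2 : ℂ) * lowpass h (toEuclideanLin ((realMat A)ᵀ⁻¹ ^ (j + 1)) s)) := by
    rw [← Finset.prod_range_reflect]
    refine Finset.prod_congr rfl fun j hj => ?_
    have hj' := Finset.mem_range.mp hj
    rw [toEuclideanLin_mul_apply, transpose_pow_mul_inv_pow hA (by omega),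
      trigPoly_eq_sqrt_two_mul_lowpass]
    congr 5
    omega
  rw [h1, Finset.prod_mul_distrib, Finset.prod_const, Finset.card_range]
  ring

theorem tendsto_toEuclideanLin_inv_pow (hexp : IsExpansive A) (hA : |A.det| = 2) (s : Rd d) :
    Filter.Tendsto (fun n : ℕ => toEuclideanLin ((realMat A)ᵀ⁻¹ ^ n) s) Filter.atTop (nhds 0) := by
  obtain ⟨C, r, hC, hr0, hr1, hd⟩ := exists_decay hexp hA
  refine squeeze_zero_norm (fun n => (hd n s).2) ?_
  simpa using ((tendsto_pow_atTop_nhds_zero_of_lt_one hr0.le hr1).const_mul C).mul_const ‖s‖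

/-- The integer translates of the scaling function satisfy the Bessel bound in the Fourier
domain. -/
theorem lintegral_trigPoly_mul_symbol_le (hexp : IsExpansive A) (hA : |A.det| = 2)
    (hh : IsLawtonSolution A h) (x : (Fin d → ℤ) →₀ ℂ) :
    ∫⁻ s, ‖trigPoly x s * symbol A h s‖ₑ ^ 2 ≤ ENNReal.ofReal (x.sum fun _ c => ‖c‖ ^ 2) := by
  have hA0 : A.det ≠ 0 := by
    intro h
    simp [h] at hA
  set Φ : ℕ → Rd d → ℝ≥0∞ := fun n => (cube d).indicator fun η =>
    ‖trigPoly ((subdiv A h)^[n] x) η‖ₑ ^ 2 with hΦ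
  have hΦm : ∀ n, Measurable (Φ n) := fun n =>
    ((continuous_trigPoly _).measurable.enorm.pow_const 2).indicator measurableSet_cube
  -- The factor `2⁻ⁿ` is the Jacobian of `(Aᵀ)⁻ⁿ`, so `F n` has the same integral as `Φ n`; the
  -- indicator restricts `s` to `(Aᵀ)ⁿ cube`.
  set F : ℕ → Rd d → ℝ≥0∞ := fun n s =>
    ENNReal.ofReal ((1 / 2) ^ n) * Φ n (toEuclideanLin ((realMat A)ᵀ⁻¹ ^ n) s) with hF
  have hFm : ∀ n, Measurable (F n) := fun n =>
    ((hΦm n).comp (measurable_toEuclideanLin _)).const_mul _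
  have hFint : ∀ n, ∫⁻ s, F n s = ENNReal.ofReal (x.sum fun _ c => ‖c‖ ^ 2) := by
    intro n
    have hdet : ((realMat A)ᵀ⁻¹ ^ n).det ≠ 0 := by
      rw [← abs_pos, abs_det_transpose_inv_pow hA]; positivity
    simp only [hF]
    rw [lintegral_const_mul (f := fun s => Φ n (toEuclideanLin ((realMat A)ᵀ⁻¹ ^ n) s)) _
        ((hΦm n).comp (measurable_toEuclideanLin _)),
      lintegral_comp_toEuclideanLin _ hdet (hΦm n), abs_inv, abs_det_transpose_inv_pow hA,
      ← mul_assoc, ← ENNReal.ofReal_mul (by positivity), mul_inv_cancel₀ (by positivity),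
      ENNReal.ofReal_one, one_mul]
    simp only [hΦ]
    rw [lintegral_indicator measurableSet_cube, lintegral_cube_trigPoly,
      sum_norm_sq_iterate_subdiv hA0 hh]
  have hlim : ∀ s, Filter.Tendsto (fun n => F n s) Filter.atTop
      (nhds (‖trigPoly x s * symbol A h s‖ₑ ^ 2)) := by
    intro s
    have h1 := ((tendsto_prod_lowpass hexp hA hh s).const_mul (trigPoly x s)).enorm
    have h2 := ((ENNReal.continuous_pow 2).tendsto _).comp h1
    refine h2.congr' ?_
    -- For fixed `s` the contracted point eventually lies in the cube, and the indicator disappears.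
    have h3 := (tendsto_toEuclideanLin_inv_pow hexp hA s).eventually
      (Metric.ball_mem_nhds 0 (by norm_num : (0 : ℝ) < 1 / 2))
    filter_upwards [h3] with n hn
    have hn' : toEuclideanLin ((realMat A)ᵀ⁻¹ ^ n) s ∈ cube d :=
      mem_cube_of_norm_lt (by simpa using hn)
    simp only [hF, hΦ, Set.indicator_of_mem hn', Function.comp_apply]
    rw [trigPoly_iterate_subdiv_inv_pow hA, enorm_mul ((Real.sqrt 2 : ℂ) ^ n), mul_pow, ← mul_assoc]
    -- The Jacobian cancels the accumulated factor `|√2ⁿ|²`.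
    have h4 : ENNReal.ofReal ((1 / 2) ^ n) * ‖(Real.sqrt 2 : ℂ) ^ n‖ₑ ^ 2 = 1 := by
      rw [← ofReal_norm, norm_pow, Complex.norm_real, Real.norm_of_nonneg (Real.sqrt_nonneg _),
        ← ENNReal.ofReal_pow (by positivity), ← ENNReal.ofReal_mul (by positivity), ← pow_mul,
        mul_comm n 2, pow_mul, Real.sq_sqrt (by norm_num), ← mul_pow]
      norm_num
    rw [h4, one_mul]
  calc ∫⁻ s, ‖trigPoly x s * symbol A h s‖ₑ ^ 2
      = ∫⁻ s, Filter.liminf (fun n => F n s) Filter.atTop :=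
        lintegral_congr fun s => ((hlim s).liminf_eq).symm
    _ ≤ Filter.liminf (fun n => ∫⁻ s, F n s) Filter.atTop := lintegral_liminf_le hFm
    _ = ENNReal.ofReal (x.sum fun _ c => ‖c‖ ^ 2) := by
        simp only [hFint, Filter.liminf_const]

theorem eLpNorm_two_sq {α : Type*} [MeasurableSpace α] {μ : Measure α} (f : α → ℂ) :
    eLpNorm f 2 μ ^ 2 = ∫⁻ x, ‖f x‖ₑ ^ 2 ∂μ := by
  rw [eLpNorm_eq_lintegral_rpow_enorm_toReal (by simp) (by simp), ← ENNReal.rpow_natCast,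
    ← ENNReal.rpow_mul]
  simp

theorem eLpNorm_trigPoly_mul_symbol_le (hexp : IsExpansive A) (hA : |A.det| = 2)
    (hh : IsLawtonSolution A h) (x : (Fin d → ℤ) →₀ ℂ) :
    eLpNorm (fun s => trigPoly x s * symbol A h s) 2 volume ≤
      ENNReal.ofReal (Real.sqrt (x.sum fun _ c => ‖c‖ ^ 2)) := by
  have h0 : 0 ≤ x.sum fun _ c => ‖c‖ ^ 2 := Finset.sum_nonneg fun _ _ => by positivity
  rw [← ENNReal.pow_le_pow_left_iff (two_ne_zero), eLpNorm_two_sq,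
    ← ENNReal.ofReal_pow (Real.sqrt_nonneg _), Real.sq_sqrt h0]
  exact lintegral_trigPoly_mul_symbol_le hexp hA hh x

theorem memLp_symbol (hexp : IsExpansive A) (hA : |A.det| = 2)
    (hh : IsLawtonSolution A h) : MemLp (symbol A h) 2 volume := by
  refine ⟨(measurable_symbol hexp hA hh).aestronglyMeasurable, ?_⟩
  -- The unit mass at `0` has trigonometric polynomial `1`, leaving the symbol alone.
  have h1 := eLpNorm_trigPoly_mul_symbol_le hexp hA hh (Finsupp.single 0 1)
  simp only [trigPoly, Finsupp.linearCombination_single, expo] at h1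
  simp only [Pi.zero_apply, Int.cast_zero, zero_mul, Finset.sum_const_zero, mul_zero, neg_zero,
    Complex.ofReal_zero, Complex.exp_zero, smul_eq_mul, one_mul] at h1
  exact h1.trans_lt ENNReal.ofReal_lt_top

end Truncation

/-! ### The Fourier transform against translations and dilations. -/

section FourierIntertwining

variable {d : ℕ}

theorem memLp_expo_mul (ℓ : Fin d → ℤ) (f : L2 d) :
    MemLp (fun s => expo ℓ s * f s) 2 (volume : Measure (Rd d)) := by
  refine (Lp.memLp f).of_le
    ((continuous_expo ℓ).aestronglyMeasurable.mul (Lp.aestronglyMeasurable f)) ?_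
  exact Filter.Eventually.of_forall fun s => by simp

/-- Multiplication by the character `e^{-2πi ℓ∘s}` as an isometry of `L²(ℝ^d)`. -/
def modulation (ℓ : Fin d → ℤ) : L2 d →ₗᵢ[ℂ] L2 d where
  toFun f := (memLp_expo_mul ℓ f).toLp _
  map_add' f g := by
    apply Lp.ext
    filter_upwards [(memLp_expo_mul ℓ (f + g)).coeFn_toLp, (memLp_expo_mul ℓ f).coeFn_toLp,
      (memLp_expo_mul ℓ g).coeFn_toLp, Lp.coeFn_add f g,
      Lp.coeFn_add ((memLp_expo_mul ℓ f).toLp _) ((memLp_expo_mul ℓ g).toLp _)] with s a b c e k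
    rw [a, k, Pi.add_apply, b, c, e, Pi.add_apply, mul_add]
  map_smul' z f := by
    apply Lp.ext
    filter_upwards [(memLp_expo_mul ℓ (z • f)).coeFn_toLp, (memLp_expo_mul ℓ f).coeFn_toLp,
      Lp.coeFn_smul z f, Lp.coeFn_smul z ((memLp_expo_mul ℓ f).toLp _)] with s a b c e
    rw [a, RingHom.id_apply, e, Pi.smul_apply, b, c, Pi.smul_apply, smul_eq_mul, smul_eq_mul]
    ring
  norm_map' f := by
    change ‖(memLp_expo_mul ℓ f).toLp _‖ = ‖f‖
    rw [Lp.norm_toLp, Lp.norm_def]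
    congr 1
    exact eLpNorm_congr_norm_ae (Filter.Eventually.of_forall fun s => by simp)

theorem coeFn_modulation (ℓ : Fin d → ℤ) (f : L2 d) :
    (modulation ℓ f : Rd d → ℂ) =ᵐ[volume] fun s => expo ℓ s * f s :=
  (memLp_expo_mul ℓ f).coeFn_toLp

/-- The integer vector `ℓ` as a vector of `ℝ^d`. -/
def intVec (ℓ : Fin d → ℤ) : Rd d := WithLp.toLp 2 fun i => (ℓ i : ℝ)

theorem coeFn_T (ℓ : Fin d → ℤ) (f : L2 d) :
    (T ℓ f : Rd d → ℂ) =ᵐ[volume] fun t => f (t - intVec ℓ) :=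
  Lp.coeFn_compMeasurePreserving f (measurePreserving_sub_right volume (intVec ℓ))

theorem fourierChar_eq_expo (ℓ : Fin d → ℤ) (s : Rd d) :
    ((Real.fourierChar (-inner ℝ (intVec ℓ) s) : Circle) : ℂ) = expo ℓ s := by
  rw [Real.fourierChar_apply, expo, mul_comm]
  congr 3
  simp only [intVec, PiLp.inner_apply, RCLike.inner_apply, conj_trivial, mul_neg]
  congr 2
  exact Finset.sum_congr rfl fun i _ => mul_comm _ _

/-- Both sides are continuous in `f`, so the identity reduces to Schwartz functions, where the
transform is an integral and can be translated directly. -/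
theorem fourier_T (ℓ : Fin d → ℤ) (f : L2 d) : 𝓕 (T ℓ f) = modulation ℓ (𝓕 f) := by
  refine DenseRange.induction_on (p := fun f : L2 d => 𝓕 (T ℓ f) = modulation ℓ (𝓕 f))
    (SchwartzMap.denseRange_toLpCLM (p := 2) ENNReal.ofNat_ne_top) f ?_ ?_
  · exact isClosed_eq
      ((Lp.fourierTransformₗᵢ (Rd d) ℂ).continuous.comp (T ℓ).continuous)
      ((modulation ℓ).continuous.comp (Lp.fourierTransformₗᵢ (Rd d) ℂ).continuous)
  intro f
  rw [SchwartzMap.toLpCLM_apply]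
  have h1 : T ℓ (f.toLp 2) = (f.compSubConstCLM ℝ (intVec ℓ)).toLp 2 := by
    apply Lp.ext
    have h2 := (measurePreserving_sub_right (volume : Measure (Rd d))
      (intVec ℓ)).quasiMeasurePreserving.ae (f.coeFn_toLp 2 volume)
    filter_upwards [coeFn_T ℓ (f.toLp 2), (f.compSubConstCLM ℝ (intVec ℓ)).coeFn_toLp 2, h2]
      with t a b c
    rw [a, b, c, SchwartzMap.compSubConstCLM_apply]
  rw [h1, SchwartzMap.toLp_fourier_eq, SchwartzMap.toLp_fourier_eq]
  apply Lp.ext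
  filter_upwards [coeFn_modulation ℓ ((𝓕 f).toLp 2), (𝓕 f).coeFn_toLp 2,
    (𝓕 (f.compSubConstCLM ℝ (intVec ℓ))).coeFn_toLp 2] with s a b c
  rw [a, b, c, SchwartzMap.fourier_coe, SchwartzMap.fourier_coe]
  have h3 := congrFun (VectorFourier.fourierIntegral_comp_add_right Real.fourierChar
    (volume : Measure (Rd d)) (innerₗ (Rd d)) f (-intVec ℓ)) s
  rw [map_neg, LinearMap.neg_apply, innerₗ_apply_apply, Circle.smul_def, fourierChar_eq_expo,
    smul_eq_mul] at h3
  have h4 : ⇑(SchwartzMap.compSubConstCLM ℝ (intVec ℓ) f) = f ∘ fun v => v + -intVec ℓ := by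
    ext v
    rw [SchwartzMap.compSubConstCLM_apply, Function.comp_apply, sub_eq_add_neg]
  rw [h4]
  exact h3

theorem integral_comp_toEuclideanLin (M : Matrix (Fin d) (Fin d) ℝ) (hM : M.det ≠ 0)
    {f : Rd d → ℂ} (hf : Continuous f) :
    ∫ s, f (toEuclideanLin M s) = (|M.det⁻¹| : ℝ) • ∫ s, f s := by
  rw [← integral_map (measurable_toEuclideanLin M).aemeasurable hf.aestronglyMeasurable,
    map_toEuclideanLin M hM, integral_smul_measure, ENNReal.toReal_ofReal (abs_nonneg _)]

/-- The continuous linear equivalence of `ℝ^d` given by an invertible matrix. -/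
def matrixEquiv (M : Matrix (Fin d) (Fin d) ℝ) (hM : M.det ≠ 0) : Rd d ≃L[ℝ] Rd d :=
  (LinearEquiv.ofLinearMap (toEuclideanLin M) (toEuclideanLin M⁻¹)
    (LinearMap.ext fun s => by
      rw [LinearMap.comp_apply, toEuclideanLin_mul_apply, mul_nonsing_inv _ hM.isUnit,
        toEuclideanLin_one_apply, LinearMap.id_apply])
    (LinearMap.ext fun s => by
      rw [LinearMap.comp_apply, toEuclideanLin_mul_apply, nonsing_inv_mul _ hM.isUnit,
        toEuclideanLin_one_apply, LinearMap.id_apply])).toContinuousLinearEquiv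

theorem inner_toEuclideanLin_transpose_inv (M : Matrix (Fin d) (Fin d) ℝ) (hM : M.det ≠ 0)
    (v w : Rd d) :
    inner ℝ (toEuclideanLin M v) (toEuclideanLin Mᵀ⁻¹ w) = inner ℝ v w := by
  simp only [EuclideanSpace.inner_eq_star_dotProduct, star_trivial, ofLp_toLpLin, toLin'_apply]
  rw [dotProduct_comm, ← vecMul_transpose, ← dotProduct_mulVec, mulVec_mulVec,
    mul_nonsing_inv _ (by rw [det_transpose]; exact hM.isUnit), one_mulVec, dotProduct_comm]

theorem fourier_comp_toEuclideanLin (M : Matrix (Fin d) (Fin d) ℝ) (hM : M.det ≠ 0)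
    {f : Rd d → ℂ} (hf : Continuous f) (s : Rd d) :
    𝓕 (fun t => f (toEuclideanLin M t)) s = (|M.det⁻¹| : ℝ) • 𝓕 f (toEuclideanLin Mᵀ⁻¹ s) := by
  rw [Real.fourier_eq, Real.fourier_eq, ← integral_comp_toEuclideanLin M hM]
  · simp only [inner_toEuclideanLin_transpose_inv M hM]
  · simp only [Circle.smul_def]
    fun_prop

/-- By density only Schwartz functions matter. There a linear substitution in the Fourier integral
moves `M` to its inverse transpose. -/
theorem fourier_U (M : Matrix (Fin d) (Fin d) ℝ) (hM : M.det ≠ 0) (hM' : Mᵀ⁻¹.det ≠ 0)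
    (f : L2 d) : 𝓕 (U M hM f) = U Mᵀ⁻¹ hM' (𝓕 f) := by
  refine DenseRange.induction_on (p := fun f : L2 d => 𝓕 (U M hM f) = U Mᵀ⁻¹ hM' (𝓕 f))
    (SchwartzMap.denseRange_toLpCLM (p := 2) ENNReal.ofNat_ne_top) f ?_ ?_
  · exact isClosed_eq
      ((Lp.fourierTransformₗᵢ (Rd d) ℂ).continuous.comp (U M hM).continuous)
      ((U Mᵀ⁻¹ hM').continuous.comp (Lp.fourierTransformₗᵢ (Rd d) ℂ).continuous)
  intro f
  rw [SchwartzMap.toLpCLM_apply]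
  set F : SchwartzMap (Rd d) ℂ := (Real.sqrt |M.det| : ℂ) •
    SchwartzMap.compCLMOfContinuousLinearEquiv ℝ (matrixEquiv M hM) f with hF
  have hF' : ⇑F = (Real.sqrt |M.det| : ℂ) • fun t => f (toEuclideanLin M t) := rfl
  have h1 : U M hM (f.toLp 2) = F.toLp 2 := by
    apply Lp.ext
    have h2 := (quasiMeasurePreserving_toEuclideanLin M hM).ae (f.coeFn_toLp 2 volume)
    filter_upwards [coeFn_UFun M hM (f.toLp 2), F.coeFn_toLp 2, h2] with t a b c
    change UFun M hM (f.toLp 2) t = _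
    rw [a, b, c, hF']
    rfl
  rw [h1, SchwartzMap.toLp_fourier_eq, SchwartzMap.toLp_fourier_eq]
  apply Lp.ext
  have h2 := (quasiMeasurePreserving_toEuclideanLin Mᵀ⁻¹ hM').ae ((𝓕 f).coeFn_toLp 2 volume)
  filter_upwards [coeFn_UFun Mᵀ⁻¹ hM' ((𝓕 f).toLp 2), (𝓕 F).coeFn_toLp 2, h2] with s a b c
  change _ = UFun Mᵀ⁻¹ hM' ((𝓕 f).toLp 2) s
  rw [a, b, c, SchwartzMap.fourier_coe, SchwartzMap.fourier_coe, hF']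
  have h3 : 𝓕 ((Real.sqrt |M.det| : ℂ) • fun t => f (toEuclideanLin M t)) s =
      (Real.sqrt |M.det| : ℂ) * 𝓕 (fun t => f (toEuclideanLin M t)) s :=
    congrFun (VectorFourier.fourierIntegral_const_smul Real.fourierChar
      (volume : Measure (Rd d)) (innerₗ (Rd d)) _ _) s
  rw [h3, fourier_comp_toEuclideanLin M hM f.continuous, Complex.real_smul, ← mul_assoc,
    ← Complex.ofReal_mul]
  -- The constants agree because `√|det M| · |det M|⁻¹ = √|det M⁻¹|`.
  congr 2
  have hpos : 0 < |M.det| := abs_pos.mpr hM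
  rw [det_nonsing_inv, det_transpose, Ring.inverse_eq_inv, abs_inv, Real.sqrt_inv]
  rw [← div_eq_mul_inv, div_eq_iff hpos.ne', ← div_eq_inv_mul, Real.div_sqrt]

theorem U_U (M N : Matrix (Fin d) (Fin d) ℝ) (hM : M.det ≠ 0) (hN : N.det ≠ 0)
    (hMN : (M * N).det ≠ 0) (f : L2 d) : U N hN (U M hM f) = U (M * N) hMN f := by
  apply Lp.ext
  have h2 := (quasiMeasurePreserving_toEuclideanLin N hN).ae (coeFn_UFun M hM f)
  filter_upwards [coeFn_UFun N hN (UFun M hM f), h2, coeFn_UFun (M * N) hMN f] with t h1 h2 h3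
  change UFun N hN (UFun M hM f) t = UFun (M * N) hMN f t
  rw [h1, h2, h3, ← mul_assoc, ← Complex.ofReal_mul, ← Real.sqrt_mul (abs_nonneg _), ← abs_mul,
    ← det_mul, toEuclideanLin_mul_apply, det_mul, det_mul, mul_comm N.det]

end FourierIntertwining

/-! ### Bessel families in an abstract Hilbert space setting. -/

section Bessel

variable {ι H : Type*} [NormedAddCommGroup H] [InnerProductSpace ℂ H]

/-- Duality: test the synthesis bound on the coefficients `aᵢ = ⟨vᵢ, f⟩` themselves. With `S = ∑
|aᵢ|²`, Cauchy–Schwarz gives `S² ≤ S ‖f‖²`, and `S` cancels unless it is zero. -/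
theorem sum_norm_inner_sq_le_of_norm_sum_sq_le {v : ι → H}
    (hv : ∀ (s : Finset ι) (a : ι → ℂ), ‖∑ i ∈ s, a i • v i‖ ^ 2 ≤ ∑ i ∈ s, ‖a i‖ ^ 2)
    (f : H) (s : Finset ι) : ∑ i ∈ s, ‖inner ℂ (v i) f‖ ^ 2 ≤ ‖f‖ ^ 2 := by
  set a : ι → ℂ := fun i => inner ℂ (v i) f
  set S : ℝ := ∑ i ∈ s, ‖a i‖ ^ 2 with hS
  have hS0 : 0 ≤ S := Finset.sum_nonneg fun _ _ => by positivity
  have h1 : inner ℂ (∑ i ∈ s, a i • v i) f = (S : ℂ) := by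
    rw [sum_inner, hS, Complex.ofReal_sum]
    refine Finset.sum_congr rfl fun i _ => ?_
    rw [inner_smul_left, Complex.conj_mul']
    simp
  have h2 := norm_inner_le_norm (𝕜 := ℂ) (∑ i ∈ s, a i • v i) f
  rw [h1, Complex.norm_real, Real.norm_of_nonneg hS0] at h2
  have h3 : S ^ 2 ≤ S * ‖f‖ ^ 2 := by
    calc S ^ 2 ≤ (‖∑ i ∈ s, a i • v i‖ * ‖f‖) ^ 2 := by gcongr
      _ = ‖∑ i ∈ s, a i • v i‖ ^ 2 * ‖f‖ ^ 2 := mul_pow _ _ _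
      _ ≤ S * ‖f‖ ^ 2 := by gcongr; exact hv s a
  rcases hS0.eq_or_lt with h0 | h0
  · rw [← h0]; positivity
  · rw [sq] at h3
    exact le_of_mul_le_mul_left h3 h0

theorem summable_norm_inner_sq {v : ι → H}
    (hv : ∀ (f : H) (s : Finset ι), ∑ i ∈ s, ‖inner ℂ (v i) f‖ ^ 2 ≤ ‖f‖ ^ 2) (f : H) :
    Summable fun i => ‖inner ℂ (v i) f‖ ^ 2 :=
  summable_of_sum_le (fun _ => by positivity) (hv f)

theorem tsum_norm_inner_sq_le {v : ι → H}
    (hv : ∀ (f : H) (s : Finset ι), ∑ i ∈ s, ‖inner ℂ (v i) f‖ ^ 2 ≤ ‖f‖ ^ 2) (f : H) :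
    ∑' i, ‖inner ℂ (v i) f‖ ^ 2 ≤ ‖f‖ ^ 2 :=
  Real.tsum_le_of_sum_le (fun _ => by positivity) (hv f)

theorem memℓp_inner {v : ι → H}
    (hv : ∀ (f : H) (s : Finset ι), ∑ i ∈ s, ‖inner ℂ (v i) f‖ ^ 2 ≤ ‖f‖ ^ 2) (f : H) :
    Memℓp (fun i => (inner ℂ (v i) f : ℂ)) 2 := by
  refine memℓp_gen ?_
  simpa using summable_norm_inner_sq hv f

/-- The square root is the `ℓ²` norm of the coefficient sequence, which is linear in `f` and
norm-decreasing, so the reverse triangle inequality applies. -/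
theorem abs_sqrt_tsum_norm_inner_sq_sub_le {v : ι → H}
    (hv : ∀ (f : H) (s : Finset ι), ∑ i ∈ s, ‖inner ℂ (v i) f‖ ^ 2 ≤ ‖f‖ ^ 2) (f g : H) :
    |√(∑' i, ‖inner ℂ (v i) f‖ ^ 2) - √(∑' i, ‖inner ℂ (v i) g‖ ^ 2)| ≤ ‖f - g‖ := by
  have hN : ∀ f : H, ‖(⟨_, memℓp_inner hv f⟩ : lp (fun _ : ι => ℂ) 2)‖ =
      √(∑' i, ‖inner ℂ (v i) f‖ ^ 2) := by
    intro f
    rw [lp.norm_eq_tsum_rpow (by simp), Real.sqrt_eq_rpow]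
    simp
  have hsub : (⟨_, memℓp_inner hv (f - g)⟩ : lp (fun _ : ι => ℂ) 2) =
      ⟨_, memℓp_inner hv f⟩ - ⟨_, memℓp_inner hv g⟩ := by
    ext i
    exact inner_sub_right _ _ _
  rw [← hN f, ← hN g]
  refine (abs_norm_sub_norm_le _ _).trans ?_
  rw [← hsub, hN, Real.sqrt_le_left (norm_nonneg _)]
  exact tsum_norm_inner_sq_le hv (f - g)

end Bessel

theorem tendsto_of_dense_of_abs_sub_le {ι H : Type*} [NormedAddCommGroup H] {l : Filter ι}
    {ψ : ι → H → ℝ} {p : H → ℝ} (hψ : ∀ i f g, |ψ i f - ψ i g| ≤ ‖f - g‖)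
    (hp : ∀ f g, |p f - p g| ≤ ‖f - g‖) {S : Set H} (hS : Dense S)
    (hlim : ∀ f ∈ S, Filter.Tendsto (fun i => ψ i f) l (nhds (p f))) (f : H) :
    Filter.Tendsto (fun i => ψ i f) l (nhds (p f)) := by
  rw [Metric.tendsto_nhds]
  intro ε hε
  obtain ⟨g, hgS, hg⟩ := Metric.dense_iff.mp hS f (ε / 3) (by positivity)
  have hfg : ‖f - g‖ < ε / 3 := by
    rwa [Metric.mem_ball, dist_comm, dist_eq_norm] at hgS
  filter_upwards [(Metric.tendsto_nhds.mp (hlim g hg)) (ε / 3) (by positivity)] with i hi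
  rw [Real.dist_eq] at hi ⊢
  have h1 := abs_le.mp (hψ i f g)
  have h2 := abs_le.mp (hp f g)
  have h3 := abs_lt.mp hi
  rw [abs_lt]
  constructor <;> linarith

/-! ### The Bessel bound for translates of the scaling function. -/

section ScalingFunction

variable {d : ℕ} {A : Matrix (Fin d) (Fin d) ℤ} {h : (Fin d → ℤ) →₀ ℂ}

theorem fourier_T_fourierInv (ℓ : Fin d → ℤ) (g : L2 d) :
    𝓕 (T ℓ (𝓕⁻ g)) = modulation ℓ g := by
  rw [fourier_T, FourierTransform.fourier_fourierInv_eq]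

theorem coeFn_linearCombination_modulation {G : Rd d → ℂ} (hG : MemLp G 2 volume)
    (x : (Fin d → ℤ) →₀ ℂ) :
    (Finsupp.linearCombination ℂ (fun ℓ => modulation ℓ (hG.toLp G)) x : Rd d → ℂ) =ᵐ[volume]
      fun s => trigPoly x s * G s := by
  induction x using Finsupp.induction_linear with
  | zero =>
    filter_upwards [Lp.coeFn_zero ℂ 2 (volume : Measure (Rd d))] with s hs
    rw [map_zero, hs]
    simp [trigPoly]
  | add x y hx hy =>
    rw [map_add]
    filter_upwards [hx, hy, Lp.coeFn_add
      (Finsupp.linearCombination ℂ (fun ℓ => modulation ℓ (hG.toLp G)) x)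
      (Finsupp.linearCombination ℂ (fun ℓ => modulation ℓ (hG.toLp G)) y)] with s a b c
    rw [c, Pi.add_apply, a, b, ← add_mul, trigPoly, trigPoly, trigPoly, map_add]
  | single n c =>
    rw [Finsupp.linearCombination_single]
    filter_upwards [Lp.coeFn_smul c (modulation n (hG.toLp G)), coeFn_modulation n (hG.toLp G),
      hG.coeFn_toLp] with s a b k
    rw [a, Pi.smul_apply, b, k, trigPoly, Finsupp.linearCombination_single, smul_eq_mul,
      smul_eq_mul, mul_assoc]

/-- By Plancherel, a combination of translates becomes a trigonometric polynomial times the symbol,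
to which the Fatou bound applies. -/
theorem norm_sum_smul_T_sq_le (hexp : IsExpansive A) (hA : |A.det| = 2)
    (hh : IsLawtonSolution A h) (s : Finset (Fin d → ℤ)) (a : (Fin d → ℤ) → ℂ) :
    ‖∑ ℓ ∈ s, a ℓ • T ℓ (𝓕⁻ ((memLp_symbol hexp hA hh).toLp _))‖ ^ 2 ≤ ∑ ℓ ∈ s, ‖a ℓ‖ ^ 2 := by
  classical
  set G := (memLp_symbol hexp hA hh).toLp _ with hG
  set x : (Fin d → ℤ) →₀ ℂ := Finsupp.indicator s fun ℓ _ => a ℓ with hx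
  have hE : (x.sum fun _ c => ‖c‖ ^ 2) = ∑ ℓ ∈ s, ‖a ℓ‖ ^ 2 :=
    Finsupp.sum_indicator_index _ (by simp)
  have h1 : ‖∑ ℓ ∈ s, a ℓ • T ℓ (𝓕⁻ G)‖ =
      ‖Finsupp.linearCombination ℂ (fun ℓ => modulation ℓ G) x‖ := by
    rw [← (Lp.fourierTransformₗᵢ (Rd d) ℂ).norm_map, map_sum, Finsupp.linearCombination_apply, hx,
      Finsupp.sum_indicator_index _ (by simp)]
    congr 1
    refine Finset.sum_congr rfl fun ℓ _ => ?_
    rw [map_smul, ← fourier_T_fourierInv]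
    rfl
  have h0 : 0 ≤ ∑ ℓ ∈ s, ‖a ℓ‖ ^ 2 := Finset.sum_nonneg fun _ _ => by positivity
  rw [h1, ← Real.le_sqrt (norm_nonneg _) h0, Lp.norm_def,
    eLpNorm_congr_ae (coeFn_linearCombination_modulation _ x), ← hE]
  exact ENNReal.toReal_le_of_le_ofReal (Real.sqrt_nonneg _)
    (eLpNorm_trigPoly_mul_symbol_le hexp hA hh x)

end ScalingFunction

/-! ### Dense classes: bounded support in space and in frequency. -/

section Density

variable {d : ℕ}

theorem dense_boundedSupport :
    Dense {f : L2 d | ∃ R : ℝ, 0 ≤ R ∧ ∀ᵐ t, R < ‖t‖ → f t = 0} := by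
  rw [Metric.dense_iff]
  intro f ε hε
  obtain ⟨g, hgc, hg, -, hgm⟩ := (Lp.memLp f).exists_hasCompactSupport_eLpNorm_sub_le
    (ENNReal.ofNat_ne_top) (ε := ENNReal.ofReal (ε / 2)) (by simpa using hε)
  refine ⟨hgm.toLp g, ?_, ?_⟩
  · rw [Metric.mem_ball, dist_comm, dist_eq_norm, Lp.norm_def]
    have h1 : (f - hgm.toLp g : L2 d) =ᵐ[volume] (f : Rd d → ℂ) - g := by
      filter_upwards [Lp.coeFn_sub f (hgm.toLp g), hgm.coeFn_toLp] with t a b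
      rw [a, Pi.sub_apply, Pi.sub_apply, b]
    rw [eLpNorm_congr_ae h1]
    exact (ENNReal.toReal_le_of_le_ofReal (by positivity) hg).trans_lt (by linarith)
  · obtain ⟨R, hR⟩ := hgc.isCompact.isBounded.subset_closedBall 0
    refine ⟨max R 0, le_max_right _ _, ?_⟩
    filter_upwards [hgm.coeFn_toLp] with t ht hRt
    rw [ht]
    by_contra h0
    have := hR (subset_tsupport g h0)
    rw [mem_closedBall_zero_iff] at this
    exact absurd (this.trans (le_max_left R 0)) (not_le.mpr hRt)

theorem dense_boundedSupport_fourier :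
    Dense {f : L2 d | ∃ R : ℝ, 0 ≤ R ∧ ∀ᵐ s, R < ‖s‖ → (𝓕 f) s = 0} :=
  dense_boundedSupport.preimage
    (Lp.fourierTransformₗᵢ (Rd d) ℂ).toHomeomorph.isOpenMap

end Density

/-! ### Estimates for functions with small support in frequency or in space. -/

section Supports

variable {d : ℕ}

theorem norm_sq_eq_integral (f : L2 d) : ‖f‖ ^ 2 = ∫ t, ‖f t‖ ^ 2 := by
  apply Complex.ofReal_injective
  have h1 := inner_self_eq_norm_sq_to_K (𝕜 := ℂ) f
  rw [L2.inner_def] at h1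
  rw [← integral_complex_ofReal]
  have h2 : ∀ t, (inner ℂ (f t) (f t) : ℂ) = ((‖f t‖ ^ 2 : ℝ) : ℂ) := fun t => by
    rw [inner_self_eq_norm_sq_to_K]; simp
  simp only [h2] at h1
  rw [h1]
  simp

theorem integrable_norm_sq (f : L2 d) : Integrable fun t => ‖f t‖ ^ 2 :=
  (memLp_two_iff_integrable_sq_norm (Lp.aestronglyMeasurable f)).mp (Lp.memLp f)

theorem inner_T_fourierInv_eq {G : Rd d → ℂ} (hG : MemLp G 2 volume) (ℓ : Fin d → ℤ)
    (f : L2 d) : inner ℂ (T ℓ (𝓕⁻ (hG.toLp G))) f =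
      ∫ s, expo (-ℓ) s * (starRingEnd ℂ (G s) * (𝓕 f) s) := by
  rw [← Lp.inner_fourier_eq, fourier_T_fourierInv, L2.inner_def]
  refine integral_congr_ae ?_
  filter_upwards [coeFn_modulation ℓ (hG.toLp G), hG.coeFn_toLp] with s a b
  rw [a, b, RCLike.inner_apply, map_mul, expo_neg]
  ring

/-- Since `F` lives in a ball inside the cube, the integrals are Fourier coefficients of `u = conj G
· F` there. Parseval turns the sum into `∫ ‖u‖²`, and `‖G‖ ≥ 1 - ε` on that ball. -/
theorem le_tsum_norm_integral_expo_sq {G : Rd d → ℂ} (hG : AEStronglyMeasurable G volume)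
    (F : L2 d) {ρ ε : ℝ} (hρ : ρ < 1 / 2) (hε : ε ≤ 1) (hGε : ∀ s, ‖s‖ ≤ ρ → ‖G s - 1‖ ≤ ε)
    (hF : ∀ᵐ s, ρ < ‖s‖ → F s = 0) :
    (1 - ε) ^ 2 * ‖F‖ ^ 2 ≤
      ∑' ℓ : Fin d → ℤ, ‖∫ s, expo (-ℓ) s * (starRingEnd ℂ (G s) * F s)‖ ^ 2 := by
  set u : Rd d → ℂ := fun s => starRingEnd ℂ (G s) * F s with hu
  have hcube : ∀ᵐ s : Rd d, s ∉ cube d → u s = 0 := by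
    filter_upwards [hF] with s hs hsc
    have : ρ < ‖s‖ := by
      by_contra! h
      exact hsc (mem_cube_of_norm_lt (h.trans_lt hρ))
    simp only [hu, hs this, mul_zero]
  have hbound : ∀ᵐ s : Rd d, ‖u s‖ ≤ (1 + ε) * ‖F s‖ ∧ (1 - ε) * ‖F s‖ ≤ ‖u s‖ := by
    filter_upwards [hF] with s hs
    rcases lt_or_ge ρ ‖s‖ with h | h
    · simp only [hu, hs h, mul_zero, norm_zero, le_refl, and_self]
    · have h1 := hGε s h
      have h2 : ‖G s‖ ≤ 1 + ε := by
        calc ‖G s‖ = ‖1 + (G s - 1)‖ := by rw [add_sub_cancel]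
          _ ≤ ‖(1 : ℂ)‖ + ‖G s - 1‖ := norm_add_le _ _
          _ ≤ 1 + ε := by rw [norm_one]; linarith
      have h3 : 1 - ε ≤ ‖G s‖ := by
        have := norm_sub_norm_le (1 : ℂ) (1 - G s)
        rw [norm_one, sub_sub_cancel, norm_sub_rev] at this
        linarith
      simp only [hu, norm_mul, RCLike.norm_conj]
      exact ⟨mul_le_mul_of_nonneg_right h2 (norm_nonneg _),
        mul_le_mul_of_nonneg_right h3 (norm_nonneg _)⟩
  have hum : MemLp u 2 volume := by
    refine (Lp.memLp F).of_le_mul (c := 1 + ε)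
      ((Complex.continuous_conj.comp_aestronglyMeasurable hG).mul
        (Lp.aestronglyMeasurable _)) ?_
    filter_upwards [hbound] with s hs using hs.1
  have hP := hasSum_norm_sq_integral_expo (hum.restrict (cube d))
  have hset : ∫ s in cube d, ‖u s‖ ^ 2 = ∫ s, ‖u s‖ ^ 2 := by
    refine setIntegral_eq_integral_of_ae_compl_eq_zero ?_
    filter_upwards [hcube] with s hs h
    rw [hs h, norm_zero, zero_pow two_ne_zero]
  have hcoef : ∀ n : Fin d → ℤ, ∫ s in cube d, expo n s * u s = ∫ s, expo n s * u s := by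
    intro n
    refine setIntegral_eq_integral_of_ae_compl_eq_zero ?_
    filter_upwards [hcube] with s hs h
    rw [hs h, mul_zero]
  simp only [hcoef, hset] at hP
  -- Conjugating the modulated function produced `expo (-ℓ)`, so the sum is reindexed by `ℓ ↦ -ℓ`.
  have hP' := (Equiv.neg (Fin d → ℤ)).hasSum_iff.mpr hP
  simp only [Function.comp_def, Equiv.neg_apply] at hP'
  rw [hP'.tsum_eq, norm_sq_eq_integral, ← integral_const_mul]
  refine integral_mono_ae ((integrable_norm_sq _).const_mul _)
    ((memLp_two_iff_integrable_sq_norm hum.1).mp hum) ?_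
  filter_upwards [hbound] with s hs
  have h0 : 0 ≤ 1 - ε := by linarith
  rw [← mul_pow]
  exact pow_le_pow_left₀ (by positivity) hs.2 2

/-- Lower frame estimate for functions of small bandwidth. -/
theorem le_tsum_norm_inner_T_sq {G : Rd d → ℂ} (hG : MemLp G 2 volume) (f : L2 d) {ρ ε : ℝ}
    (hρ : ρ < 1 / 2) (hε : ε ≤ 1) (hGε : ∀ s, ‖s‖ ≤ ρ → ‖G s - 1‖ ≤ ε)
    (hf : ∀ᵐ s, ρ < ‖s‖ → (𝓕 f) s = 0) :
    (1 - ε) ^ 2 * ‖f‖ ^ 2 ≤ ∑' ℓ, ‖inner ℂ (T ℓ (𝓕⁻ (hG.toLp G))) f‖ ^ 2 := by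
  simp only [inner_T_fourierInv_eq]
  rw [← Lp.norm_fourier_eq f]
  exact le_tsum_norm_integral_expo_sq hG.1 (𝓕 f) hρ hε hGε hf

/-- Against `g` supported in a `ρ`-ball at the origin, `T ℓ φ` may be replaced by the translate of
`φ` cut off to the ball about `-ℓ`; then Cauchy–Schwarz. -/
theorem norm_inner_T_sq_le (φ g : L2 d) (ℓ : Fin d → ℤ) {ρ : ℝ}
    (hg : ∀ᵐ t, ρ < ‖t‖ → g t = 0) :
    ‖inner ℂ (T ℓ φ) g‖ ^ 2 ≤
      (∫ t in Metric.closedBall (-intVec ℓ) ρ, ‖φ t‖ ^ 2) * ‖g‖ ^ 2 := by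
  have hm : MemLp ((Metric.closedBall (-intVec ℓ) ρ).indicator φ) 2 volume :=
    (Lp.memLp φ).indicator Metric.isClosed_closedBall.measurableSet
  have h1 : inner ℂ (T ℓ φ) g = inner ℂ (T ℓ (hm.toLp _)) g := by
    rw [L2.inner_def, L2.inner_def]
    refine integral_congr_ae ?_
    have h2 := (measurePreserving_sub_right (volume : Measure (Rd d))
      (intVec ℓ)).quasiMeasurePreserving.ae hm.coeFn_toLp
    filter_upwards [coeFn_T ℓ φ, coeFn_T ℓ (hm.toLp _), h2, hg] with t a b c e
    rw [a, b, c]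
    by_cases ht : ρ < ‖t‖
    · simp [e ht]
    · rw [Set.indicator_of_mem]
      simpa [dist_eq_norm] using not_lt.mp ht
  have h3 : ‖hm.toLp _‖ ^ 2 = ∫ t in Metric.closedBall (-intVec ℓ) ρ, ‖φ t‖ ^ 2 := by
    rw [norm_sq_eq_integral, ← integral_indicator Metric.isClosed_closedBall.measurableSet]
    refine integral_congr_ae ?_
    filter_upwards [hm.coeFn_toLp] with t ht
    rw [ht]
    by_cases h : t ∈ Metric.closedBall (-intVec ℓ) ρ <;> simp [h]
  rw [h1, ← h3, ← (T ℓ).norm_map (hm.toLp _), ← mul_pow]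
  exact pow_le_pow_left₀ (norm_nonneg _) (norm_inner_le_norm _ _) 2

theorem one_le_dist_intVec {ℓ m : Fin d → ℤ} (h : ℓ ≠ m) : 1 ≤ dist (-intVec ℓ) (-intVec m) := by
  obtain ⟨i, hi⟩ := Function.ne_iff.mp h
  rw [dist_neg_neg, dist_eq_norm]
  refine le_trans ?_ (PiLp.norm_apply_le _ i)
  have h1 : (intVec ℓ - intVec m) i = ((ℓ i - m i : ℤ) : ℝ) := by
    simp [intVec]
  rw [h1, Real.norm_eq_abs, ← Int.cast_abs]
  exact_mod_cast Int.one_le_abs (sub_ne_zero.mpr hi)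

/-- Balls of radius `1/3` about distinct lattice points are disjoint, so the masses sum to at most
that of `φ`. This is the dominating series below. -/
theorem summable_integral_closedBall (φ : L2 d) :
    Summable fun ℓ : Fin d → ℤ => ∫ t in Metric.closedBall (-intVec ℓ) (1 / 3), ‖φ t‖ ^ 2 := by
  refine (hasSum_integral_iUnion (fun ℓ => Metric.isClosed_closedBall.measurableSet) ?_
    (integrable_norm_sq φ).integrableOn).summable
  intro ℓ m hlm
  refine Metric.closedBall_disjoint_closedBall ?_
  have := one_le_dist_intVec hlm
  linarith

/-- Dominated convergence over `ℓ`: each term is at most `M²` times the mass of `φ` on a ball of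
vanishing volume. Dimension zero is excluded because a point has volume `1` there. -/
theorem tendsto_tsum_norm_inner_T_sq_zero (hd : d ≠ 0) (φ : L2 d) {g : ℕ → L2 d} {M : ℝ}
    (hM : ∀ n, ‖g n‖ ≤ M) {ρ : ℕ → ℝ} (hρ0 : ∀ n, 0 ≤ ρ n)
    (hρ : Filter.Tendsto ρ Filter.atTop (nhds 0))
    (hg : ∀ n, ∀ᵐ t, ρ n < ‖t‖ → (g n) t = 0) :
    Filter.Tendsto (fun n => ∑' ℓ, ‖inner ℂ (T ℓ φ) (g n)‖ ^ 2) Filter.atTop (nhds 0) := by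
  have hint : ∀ s : Set (Rd d), 0 ≤ ∫ t in s, ‖φ t‖ ^ 2 := fun s =>
    integral_nonneg fun t => by positivity
  have hle : ∀ n ℓ, ‖inner ℂ (T ℓ φ) (g n)‖ ^ 2 ≤
      (∫ t in Metric.closedBall (-intVec ℓ) (ρ n), ‖φ t‖ ^ 2) * M ^ 2 := fun n ℓ =>
    (norm_inner_T_sq_le φ (g n) ℓ (hg n)).trans (mul_le_mul_of_nonneg_left
      (pow_le_pow_left₀ (norm_nonneg _) (hM n) 2) (hint _))
  have hvol : ∀ x : Rd d, Filter.Tendsto (fun n => volume (Metric.closedBall x (ρ n)))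
      Filter.atTop (nhds 0) := by
    intro x
    simp only [fun n => Measure.addHaar_closedBall (volume : Measure (Rd d)) x (hρ0 n)]
    have h1 : Filter.Tendsto (fun n => ENNReal.ofReal (ρ n ^ Module.finrank ℝ (Rd d)))
        Filter.atTop (nhds 0) := by
      have := ENNReal.tendsto_ofReal (hρ.pow (Module.finrank ℝ (Rd d)))
      simpa [hd] using this
    have h2 := ENNReal.Tendsto.mul_const h1
      (Or.inr (measure_ball_lt_top (μ := (volume : Measure (Rd d))) (x := 0) (r := 1)).ne)
    simpa using h2
  rw [← tsum_zero (α := ℝ) (β := Fin d → ℤ)]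
  refine tendsto_tsum_of_dominated_convergence
    ((summable_integral_closedBall φ).mul_right (M ^ 2)) (fun ℓ => ?_) ?_
  · refine squeeze_zero (fun n => by positivity) (fun n => hle n ℓ) ?_
    simpa using ((integrable_norm_sq φ).tendsto_setIntegral_nhds_zero
      (hvol (-intVec ℓ))).mul_const (M ^ 2)
  · filter_upwards [hρ.eventually (gt_mem_nhds (by norm_num : (0 : ℝ) < 1 / 3))] with n hn ℓ
    rw [Real.norm_of_nonneg (by positivity)]
    refine (hle n ℓ).trans (mul_le_mul_of_nonneg_right ?_ (by positivity))
    exact setIntegral_mono_set (integrable_norm_sq φ).integrableOn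
      (Filter.Eventually.of_forall fun t => by positivity)
      (Metric.closedBall_subset_closedBall hn.le).eventuallyLE

/-- Writing `t = N (N⁻¹ t)`, the bound on `N` forces `‖N⁻¹ t‖ > R` once `‖t‖ > c R`: undoing a
dilation by a contraction shrinks the support. -/
theorem ae_eq_zero_of_U (N : Matrix (Fin d) (Fin d) ℝ) (hN : N.det ≠ 0) {c R : ℝ}
    (hc : 0 ≤ c) (hNc : ∀ x, ‖toEuclideanLin N x‖ ≤ c * ‖x‖) (g : L2 d)
    (hR : ∀ᵐ s, R < ‖s‖ → (U N hN g) s = 0) : ∀ᵐ t, c * R < ‖t‖ → g t = 0 := by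
  have hN' : N⁻¹.det ≠ 0 := by rw [det_nonsing_inv]; simpa using hN
  have h1 : ∀ᵐ s, (UFun N hN g) s = (Real.sqrt |N.det| : ℂ) * g (toEuclideanLin N s) :=
    coeFn_UFun N hN g
  have h2 := (quasiMeasurePreserving_toEuclideanLin N⁻¹ hN').ae (h1.and hR)
  filter_upwards [h2] with t ht hct
  have h3 : toEuclideanLin N (toEuclideanLin N⁻¹ t) = t := by
    rw [toEuclideanLin_mul_apply, mul_nonsing_inv _ hN.isUnit, toEuclideanLin_one_apply]
  have h4 : R < ‖toEuclideanLin N⁻¹ t‖ := by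
    have := hNc (toEuclideanLin N⁻¹ t)
    rw [h3] at this
    exact lt_of_mul_lt_mul_left (hct.trans_le this) hc
  have h5 := ht.2 h4
  change UFun N hN g _ = 0 at h5
  rw [ht.1, h3] at h5
  refine (mul_eq_zero.mp h5).resolve_left ?_
  exact Complex.ofReal_ne_zero.mpr (Real.sqrt_ne_zero'.mpr (abs_pos.mpr hN))

end Supports

/-! ### Passage between the `2π` normalization and period 1. -/

section Scaling

variable {d : ℕ} {A : Matrix (Fin d) (Fin d) ℤ} {h : (Fin d → ℤ) →₀ ℂ}

theorem sqrt_abs_det_two_pi_inv_smul_one :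
    Real.sqrt |((2 * Real.pi)⁻¹ • (1 : Matrix (Fin d) (Fin d) ℝ)).det| =
      ((2 * Real.pi) ^ ((d : ℝ) / 2))⁻¹ := by
  have hpi : (0 : ℝ) < 2 * Real.pi := by positivity
  rw [det_smul, det_one, mul_one, Fintype.card_fin, abs_of_pos (by positivity), inv_pow,
    Real.sqrt_inv, Real.sqrt_eq_rpow, ← Real.rpow_natCast, ← Real.rpow_mul hpi.le, mul_one_div]

/-- The constant `(2π)^{-d/2}` is exactly the unitary normalization of the dilation by `(2π)⁻¹`. -/
theorem gFun_eq_symbol (ξ : Rd d) :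
    gFun A h ξ = (Real.sqrt |((2 * Real.pi)⁻¹ • (1 : Matrix (Fin d) (Fin d) ℝ)).det| : ℂ) *
      symbol A h (toEuclideanLin ((2 * Real.pi)⁻¹ • (1 : Matrix (Fin d) (Fin d) ℝ)) ξ) := by
  have h1 : toEuclideanLin ((2 * Real.pi)⁻¹ • (1 : Matrix (Fin d) (Fin d) ℝ)) ξ =
      (2 * Real.pi)⁻¹ • ξ := by
    rw [map_smul, LinearMap.smul_apply, toEuclideanLin_one_apply]
  have h2 : ξ = (2 * Real.pi) • (2 * Real.pi)⁻¹ • ξ := by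
    rw [smul_inv_smul₀ (by positivity)]
  rw [gFun, sqrt_abs_det_two_pi_inv_smul_one, h1, symbol, Complex.ofReal_inv, one_div]
  congr 1
  refine tprod_congr fun j => ?_
  conv_lhs => rw [h2]
  exact factor_two_pi_smul A h _ _

theorem det_two_pi_inv_smul_one_ne_zero :
    ((2 * Real.pi)⁻¹ • (1 : Matrix (Fin d) (Fin d) ℝ)).det ≠ 0 := by
  rw [det_smul, det_one, mul_one]
  exact pow_ne_zero _ (inv_ne_zero (by positivity))

theorem gFun_ae_eq (hG : MemLp (symbol A h) 2 volume) :
    gFun A h =ᵐ[volume] U ((2 * Real.pi)⁻¹ • (1 : Matrix (Fin d) (Fin d) ℝ))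
      det_two_pi_inv_smul_one_ne_zero (hG.toLp _) := by
  have h2 := (quasiMeasurePreserving_toEuclideanLin _
    (det_two_pi_inv_smul_one_ne_zero (d := d))).ae hG.coeFn_toLp
  filter_upwards [coeFn_UFun _ (det_two_pi_inv_smul_one_ne_zero (d := d)) (hG.toLp _), h2]
    with ξ a b
  rw [gFun_eq_symbol, ← b]
  exact a.symm

theorem memLp_gFun (hG : MemLp (symbol A h) 2 volume) : MemLp (gFun A h) 2 volume :=
  (memLp_congr_ae (gFun_ae_eq hG)).mpr (Lp.memLp _)

/-- The dilation by `(2π)⁻¹` in `gFun` cancels the one built into `fourier`, leaving Mathlib's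
inverse transform. -/
theorem scalingFun_eq (hG : MemLp (symbol A h) 2 volume) :
    scalingFun A h = 𝓕⁻ (hG.toLp _) := by
  have h1 : (memLp_gFun hG).toLp _ = U ((2 * Real.pi)⁻¹ • (1 : Matrix (Fin d) (Fin d) ℝ))
      det_two_pi_inv_smul_one_ne_zero (hG.toLp _) :=
    Lp.ext ((memLp_gFun hG).coeFn_toLp.trans (gFun_ae_eq hG))
  rw [scalingFun, dif_pos (memLp_gFun hG), h1, fourier, LinearIsometryEquiv.symm_trans]
  rw [LinearIsometryEquiv.trans_apply, LinearIsometryEquiv.symm_apply_apply]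
  rfl

theorem multipliable_factor (hexp : IsExpansive A) (hA : |A.det| = 2)
    (hh : IsLawtonSolution A h) (ξ : Rd d) : Multipliable fun j : ℕ => factor A h ξ (j + 1) := by
  have h2 : ξ = (2 * Real.pi) • (2 * Real.pi)⁻¹ • ξ := by
    rw [smul_inv_smul₀ (by positivity)]
  rw [h2]
  simpa only [factor_two_pi_smul] using multipliable_lowpass hexp hA hh ((2 * Real.pi)⁻¹ • ξ)

end Scaling

/-! ### The two limits on the dense classes. -/

section Limits

variable {d : ℕ} {A : Matrix (Fin d) (Fin d) ℤ} {h : (Fin d → ℤ) →₀ ℂ}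

theorem D_pow_apply (hA : |A.det| = 2) (n : ℕ) (hn : (realMat A ^ n).det ≠ 0) (f : L2 d) :
    (D A hA ^ n) f = U (realMat A ^ n) hn f := by
  induction n generalizing f with
  | zero =>
    apply Lp.ext
    filter_upwards [coeFn_UFun (realMat A ^ 0) hn f] with t ht
    change f t = UFun (realMat A ^ 0) hn f t
    rw [ht, pow_zero, toEuclideanLin_one_apply]
    simp
  | succ n ih =>
    have hn' : (realMat A ^ n).det ≠ 0 := by
      rw [det_pow]; exact pow_ne_zero _ (det_realMat_ne_zero hA)
    rw [pow_succ, LinearIsometryEquiv.coe_mul, Function.comp_apply, ih hn', D,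
      U_U _ _ _ hn' (by rwa [← pow_succ'])]
    simp only [pow_succ']

theorem coeff_eq_inner (hA : |A.det| = 2) (J : ℤ) (f : L2 d) (ℓ : Fin d → ℤ) :
    coeff A hA h J f ℓ = inner ℂ (T ℓ (scalingFun A h)) ((D A hA ^ J).symm f) := by
  rw [coeff, LinearIsometryEquiv.inner_map_eq_flip]

theorem ne_zero_of_abs_det_eq_two (hA : |A.det| = 2) : d ≠ 0 := by
  rintro rfl
  simp at hA

theorem det_realMat_pow_ne_zero (hA : |A.det| = 2) (n : ℕ) : (realMat A ^ n).det ≠ 0 := by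
  rw [det_pow]; exact pow_ne_zero _ (det_realMat_ne_zero hA)

/-- A squeeze between the Bessel bound and the small-bandwidth lower bound for `g = D_A⁻ⁿ f`, whose
spectrum lies in a ball of radius `C rⁿ R`. -/
theorem tendsto_LJ_natCast (hexp : IsExpansive A) (hA : |A.det| = 2) (hh : IsLawtonSolution A h)
    (hle : ∀ J f, LJ A hA h J f ≤ ‖f‖ ^ 2) {f : L2 d} {R : ℝ}
    (hf : ∀ᵐ s, R < ‖s‖ → (𝓕 f) s = 0) :
    Filter.Tendsto (fun n : ℕ => LJ A hA h n f) Filter.atTop (nhds (‖f‖ ^ 2)) := by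
  obtain ⟨C, r, hC, hr0, hr1, hd⟩ := exists_decay hexp hA
  obtain ⟨K, hK, hG⟩ := exists_norm_symbol_sub_one_le hexp hA hh
  have hρ : Filter.Tendsto (fun n : ℕ => C * r ^ n * R) Filter.atTop (nhds 0) := by
    simpa using ((tendsto_pow_atTop_nhds_zero_of_lt_one hr0.le hr1).const_mul C).mul_const R
  have hε : Filter.Tendsto (fun n : ℕ => Real.exp (K * (C * r ^ n * R)) - 1) Filter.atTop
      (nhds 0) := by
    have := ((Real.continuous_exp.tendsto _).comp (hρ.const_mul K)).sub_const 1
    simpa using this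
  have hlow : Filter.Tendsto
      (fun n : ℕ => (1 - (Real.exp (K * (C * r ^ n * R)) - 1)) ^ 2 * ‖f‖ ^ 2)
      Filter.atTop (nhds (‖f‖ ^ 2)) := by
    simpa using ((hε.const_sub 1).pow 2).mul_const (‖f‖ ^ 2)
  refine tendsto_of_tendsto_of_tendsto_of_le_of_le' hlow tendsto_const_nhds ?_
    (Filter.Eventually.of_forall fun n => hle n f)
  filter_upwards [hρ.eventually (gt_mem_nhds (by norm_num : (0 : ℝ) < 1 / 2)),
    hε.eventually (gt_mem_nhds one_pos)] with n hn1 hn2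
  have hdet := det_realMat_pow_ne_zero hA n
  have hdet' : (realMat A ^ n)ᵀ⁻¹.det ≠ 0 := by
    rw [det_nonsing_inv, det_transpose]; simpa using hdet
  set g : L2 d := (D A hA ^ (n : ℤ)).symm f with hg
  have hgf : 𝓕 f = U (realMat A ^ n)ᵀ⁻¹ hdet' (𝓕 g) := by
    rw [← fourier_U _ hdet, ← D_pow_apply hA n hdet g, hg, zpow_natCast,
      LinearIsometryEquiv.apply_symm_apply]
  have hsupp : ∀ᵐ s, C * r ^ n * R < ‖s‖ → (𝓕 g) s = 0 := by
    refine ae_eq_zero_of_U _ hdet' (by positivity) (fun x => ?_) (𝓕 g) (by rwa [← hgf])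
    rw [transpose_pow, ← inv_pow']
    exact (hd n x).2
  have key := le_tsum_norm_inner_T_sq (memLp_symbol hexp hA hh) g hn1 hn2.le (fun s hs =>
    (hG s).trans (sub_le_sub_right (Real.exp_le_exp.mpr (mul_le_mul_of_nonneg_left hs hK)) 1)) hsupp
  rw [hg, LinearIsometryEquiv.norm_map] at key
  simpa only [LJ, coeff_eq_inner, scalingFun_eq (memLp_symbol hexp hA hh)] using key

/-- Negative powers of `D_A` move onto `f` as `f ∘ Aⁿ`, up to normalization; this keeps the norm and
shrinks the support to radius `C rⁿ R`. -/
theorem tendsto_LJ_neg_natCast (hexp : IsExpansive A) (hA : |A.det| = 2) {f : L2 d} {R : ℝ}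
    (hR : 0 ≤ R) (hf : ∀ᵐ t, R < ‖t‖ → f t = 0) :
    Filter.Tendsto (fun n : ℕ => LJ A hA h (-(n : ℤ)) f) Filter.atTop (nhds 0) := by
  obtain ⟨C, r, hC, hr0, hr1, hd⟩ := exists_decay hexp hA
  have hρ : Filter.Tendsto (fun n : ℕ => C * r ^ n * R) Filter.atTop (nhds 0) := by
    simpa using ((tendsto_pow_atTop_nhds_zero_of_lt_one hr0.le hr1).const_mul C).mul_const R
  simp only [LJ, coeff_eq_inner]
  refine tendsto_tsum_norm_inner_T_sq_zero (ne_zero_of_abs_det_eq_two hA) _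
    (M := ‖f‖) (fun n => ?_) (ρ := fun n => C * r ^ n * R) (fun n => by positivity) hρ fun n => ?_
  · rw [LinearIsometryEquiv.norm_map]
  · have hdet := det_realMat_pow_ne_zero hA n
    have hdet' : (realMat A ^ n)⁻¹.det ≠ 0 := by
      rw [det_nonsing_inv]; simpa using hdet
    have hfg : U (realMat A ^ n)⁻¹ hdet' ((D A hA ^ (-(n : ℤ))).symm f) = f := by
      have h1 : (D A hA ^ (-(n : ℤ))).symm f = U (realMat A ^ n) hdet f := by
        rw [← D_pow_apply hA n hdet, _root_.zpow_neg, zpow_natCast]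
        rfl
      rw [h1]
      exact UFun_UFun _ _ hdet hdet' (mul_nonsing_inv _ hdet.isUnit) f
    refine ae_eq_zero_of_U _ hdet' (by positivity) (fun x => ?_) _ (by rwa [hfg])
    rw [← inv_pow']
    exact (hd n x).1

end Limits

end ParsevalWavelet

end

theorem proposition8p4 {d : ℕ} (A : Matrix (Fin d) (Fin d) ℤ)
    (hexp : ParsevalWavelet.IsExpansive A) (hdet : |A.det| = 2)
    (hpart : ParsevalWavelet.HasPartition A)
    (h : (Fin d → ℤ) →₀ ℂ) (hh : ParsevalWavelet.IsLawtonSolution A h) :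
    (∀ ξ, Multipliable fun j : ℕ => ParsevalWavelet.factor A h ξ (j + 1)) ∧
    MeasureTheory.MemLp (ParsevalWavelet.gFun A h) 2 MeasureTheory.volume ∧
    ∀ f : ParsevalWavelet.L2 d,
      (∀ J : ℤ, Summable fun ℓ => ‖ParsevalWavelet.coeff A hdet h J f ℓ‖ ^ 2) ∧
      Filter.Tendsto (fun J : ℤ => ParsevalWavelet.LJ A hdet h J f) Filter.atTop
        (nhds (‖f‖ ^ 2)) ∧
      Filter.Tendsto (fun J : ℤ => ParsevalWavelet.LJ A hdet h J f) Filter.atBot (nhds 0) := by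
  open ParsevalWavelet in
  have hG := memLp_symbol hexp hdet hh
  have hB : ∀ (f : L2 d) (s : Finset (Fin d → ℤ)),
      ∑ ℓ ∈ s, ‖inner ℂ (T ℓ (scalingFun A h)) f‖ ^ 2 ≤ ‖f‖ ^ 2 := by
    rw [scalingFun_eq hG]
    exact sum_norm_inner_sq_le_of_norm_sum_sq_le (norm_sum_smul_T_sq_le hexp hdet hh)
  have hle : ∀ J f, LJ A hdet h J f ≤ ‖f‖ ^ 2 := fun J f => by
    have := tsum_norm_inner_sq_le hB ((D A hdet ^ J).symm f)
    rw [LinearIsometryEquiv.norm_map] at this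
    simpa only [LJ, coeff_eq_inner] using this
  have h0 : ∀ J f, 0 ≤ LJ A hdet h J f := fun J f => tsum_nonneg fun ℓ => by positivity
  -- Unitarity of `D_A^J` makes the Lipschitz constant `1` for every `J`, which allows passing from
  -- dense sets to all `f`.
  have hlip : ∀ J f g, |√(LJ A hdet h J f) - √(LJ A hdet h J g)| ≤ ‖f - g‖ := fun J f g => by
    have := abs_sqrt_tsum_norm_inner_sq_sub_le hB ((D A hdet ^ J).symm f) ((D A hdet ^ J).symm g)
    rw [← map_sub, LinearIsometryEquiv.norm_map] at this
    simpa only [LJ, coeff_eq_inner] using this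
  refine ⟨multipliable_factor hexp hdet hh, memLp_gFun hG, fun f => ⟨fun J => ?_, ?_, ?_⟩⟩
  · simpa only [coeff_eq_inner] using summable_norm_inner_sq hB ((D A hdet ^ J).symm f)
  · have h1 : ∀ f : L2 d, Filter.Tendsto (fun n : ℕ => √(LJ A hdet h n f)) Filter.atTop
        (nhds ‖f‖) :=
      tendsto_of_dense_of_abs_sub_le (fun n => hlip n) abs_norm_sub_norm_le
        dense_boundedSupport_fourier fun f ⟨R, _, hf⟩ => by
          simpa using (tendsto_LJ_natCast hexp hdet hh hle hf).sqrt
    have h2 := (h1 f).pow 2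
    simp only [Real.sq_sqrt (h0 _ _)] at h2
    rw [← Nat.map_cast_int_atTop, Filter.tendsto_map'_iff]
    exact h2
  · have h1 : ∀ f : L2 d, Filter.Tendsto (fun n : ℕ => √(LJ A hdet h (-(n : ℤ)) f)) Filter.atTop
        (nhds 0) :=
      tendsto_of_dense_of_abs_sub_le (p := fun _ => 0) (fun n => hlip _) (fun f g => by simp)
        dense_boundedSupport fun f ⟨R, hR, hf⟩ => by
          simpa using (tendsto_LJ_neg_natCast (h := h) hexp hdet hR hf).sqrt
    have h2 := (h1 f).pow 2
    simp only [Real.sq_sqrt (h0 _ _), zero_pow two_ne_zero] at h2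
    rw [← Filter.map_neg_atTop, ← Nat.map_cast_int_atTop, Filter.map_map, Filter.tendsto_map'_iff]
    exact h2
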